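/- Let $(M,\bar g)$ be a hyperkähler $4n$-manifold: a smooth Riemannian manifold with Levi-Civita connection $\bar\nabla$ and three $\bar g$-compatible parallel complex structures $J_1,J_2,J_3$ such that $J_1^2=J_2^2=J_3^2=J_1J_2J_3=-\mathrm{Id}$. For $c\in S^2\subset\mathbb R^3$ put $J_c=\sum_d c_dJ_d$ and, for a unit vector $k\perp c$, $\Omega_c=\bar g(J_cJ_k\,\cdot,\cdot)-\sqrt{-1}\,\bar g(J_k\,\cdot,\cdot)$ (changing $k$ multiplies $\Omega_c$ by a unit complex number). Let $L$ be a smoothly immersed submanifold of $M$ of dimension $2n$, with the induced metric, that is hyper-Lagrangian with smooth complex phase $\Psi=\mathbf a=(a_1,a_2,a_3)\colon L\to S^2$, i.e. $\Omega_{\Psi(x)}|_{T_xL}=0$ for every $x\in L$. Write $J_\Psi=\sum_d a_dJ_d$, let $A$ be the second fundamental form of $L$, and let $$|\bar\nabla J_\Psi|^2=\sum_{i,A,B}\bar g\big((\bar\nabla_iJ_\Psi)(e_A),e_B\big)^2,\qquad |\nabla\mathbf a|^2=\sum_d|\nabla a_d|^2,$$ where $e_i$ runs through an orthonormal basis of $T_xL$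 and $e_A,e_B$ through an orthonormal basis of $T_xM$. (1) Let $\Phi$ be a smooth map to $S^2$, defined on an open set $U\subset L$, with $\Phi(x)\perp\Psi(x)$ for all $x\in U$; let $e_1,\dots,e_{2n}$ be a smooth orthonormal frame of $TL$ on $U$ with $J_\Psi e_{2\nu-1}=e_{2\nu}$ for $1\le\nu\le n$, and let $e_{2n+i}=J_\Phi e_i$ for $1\le i\le 2n$ (the canonical frame adapted to $(\Psi,\Phi)$). Put $h^\alpha_{ij}=\bar g(e_i,\bar\nabla_{e_j}e_\alpha)$ for $1\le i,j\le 2n<\alpha\le 4n$. Then, at every point of $U$, $$|\bar\nabla J_\Psi|^2=4\sum_{i=1}^{2n}\sum_{\nu=1}^{n}\sum_{\mu=n+1}^{2n}\Big[\big(h^{2\mu-1}_{2\nu,i}-h^{2\mu}_{2\nu-1,i}\big)^2+\big(h^{2\mu-1}_{2\nu-1,i}+h^{2\mu}_{2\nu,i}\big)^2\Big].$$ (2) There is a constant $c(n)$, depending only on $n$, such that at every point of $L$ $$|\nabla\Psi|\le c(n)\,|A|,$$ whether $|\nabla\Psi|$ is understood as $|\bar\nabla J_\Psi|$ or as $|\nabla\mathbf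 a|$. -/

import Mathlib

open Bundle
open scoped Manifold ContDiff

noncomputable section

namespace HyperLagrangian

/-! ### Covariant derivatives along a map -/

instance finiteDimensional_tangentSpace {E : Type*} [NormedAddCommGroup E] [NormedSpace ℝ E]
    [FiniteDimensional ℝ E] {H : Type*} [TopologicalSpace H] {I : ModelWithCorners ℝ E H}
    {M : Type*} [TopologicalSpace M] [ChartedSpace H M] (p : M) :
    FiniteDimensional ℝ (TangentSpace I p) :=
  inferInstanceAs (FiniteDimensional ℝ E)

section Along

variable {E : Type*} [NormedAddCommGroup E] [NormedSpace ℝ E]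
  {H : Type*} [TopologicalSpace H] {I : ModelWithCorners ℝ E H}
  {M : Type*} [TopologicalSpace M] [ChartedSpace H M] [IsManifold I 1 M]
  {E' : Type*} [NormedAddCommGroup E'] [NormedSpace ℝ E']
  {H' : Type*} [TopologicalSpace H'] {I' : ModelWithCorners ℝ E' H'}
  {L : Type*} [TopologicalSpace L] [ChartedSpace H' L] [IsManifold I' 1 L]

/-- The pull-back connection: the covariant derivative `∇̄_v V` of a vector field `V` along
`F : L → M` in the direction `v ∈ T_x L`. If `∂₁, …, ∂ₘ` is the coordinate frame of `TM` given by
the preferred chart at `F x` and `V y = ∑ Vᵏ(y) ∂ₖ(F y)`, then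
`∇̄_v V = ∑ dVᵏ(v) ∂ₖ(F x) + ∑ Vᵏ(x) ∇_{dF v} ∂ₖ`: the first summand below differentiates the
coefficients, and `FiberBundle.extend E (V x)` is the vector field `∑ Vᵏ(x) ∂ₖ`. -/
def covAlong (cov : CovariantDerivative I E (TangentSpace I : M → Type _)) (F : L → M)
    (V : (y : L) → TangentSpace I (F y)) (x : L) :
    TangentSpace I' x →L[ℝ] TangentSpace I (F x) :=
  letI t := trivializationAt E (TangentSpace I : M → Type _) (F x)
  (t.symmL ℝ (F x)).comp
      (mvfderiv I' (fun y : L => (t (⟨F y, V y⟩ : TangentBundle I M)).2) x)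
    + (cov (FiberBundle.extend E (V x)) (F x)).comp (mfderiv I' I F x)

/-- The covariant derivative of a field `S` of endomorphisms of `TM` along `F : L → M`,
`(∇̄_v S)(w) = ∇̄_v (S W) - S (∇̄_v W)`, where `W` is a vector field along `F` with `W x = w`
(the one with constant coefficients in the coordinate frame at `F x`). -/
def covEndAlong (cov : CovariantDerivative I E (TangentSpace I : M → Type _)) (F : L → M)
    (S : (y : L) → TangentSpace I (F y) →L[ℝ] TangentSpace I (F y)) (x : L)
    (v : TangentSpace I' x) (w : TangentSpace I (F x)) : TangentSpace I (F x) :=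
  letI W : (y : L) → TangentSpace I (F y) := fun y => FiberBundle.extend E w (F y)
  covAlong cov F (fun y => S y (W y)) x v - S x (covAlong cov F W x v)

variable [FiniteDimensional ℝ E] [FiniteDimensional ℝ E']
  [RiemannianBundle (fun p : M => TangentSpace I p)]
  [RiemannianBundle (fun y : L => TangentSpace I' y)]

/-- `|∇̄S|² = ∑_{i,A,B} ḡ((∇̄_i S)(e_A), e_B)²`, where `e_i` runs through an orthonormal basis of
`T_x L` and `e_A`, `e_B` run through an orthonormal basis of `T_{F x} M`. -/
def normSqCovEndAlong (cov : CovariantDerivative I E (TangentSpace I : M → Type _)) (F : L → M)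
    (S : (y : L) → TangentSpace I (F y) →L[ℝ] TangentSpace I (F y)) (x : L) : ℝ :=
  letI ε := stdOrthonormalBasis ℝ (TangentSpace I' x)
  letI η := stdOrthonormalBasis ℝ (TangentSpace I (F x))
  ∑ i, ∑ A, ∑ B, (inner ℝ (covEndAlong cov F S x (ε i) (η A)) (η B)) ^ 2

/-- The second fundamental form `A(v, w) = (∇̄_v (dF W))^⊥` of an immersion `F : L → M` at `x`,
where `W` is a vector field on `L` with `W x = w`, and `⊥` is the orthogonal projection onto the
normal space, the orthogonal complement of `dF(T_x L)`. -/
def secondFundamentalForm (cov : CovariantDerivative I E (TangentSpace I : M → Type _)) (F : L → M)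
    (x : L) (v w : TangentSpace I' x) : TangentSpace I (F x) :=
  letI T : Submodule ℝ (TangentSpace I (F x)) := (mfderiv I' I F x).range
  Tᗮ.starProjection
    (covAlong cov F (fun y => mfderiv I' I F y (FiberBundle.extend E' w y)) x v)

/-- The squared norm `|A|² = ∑_{i,j} |A(e_i, e_j)|²` of the second fundamental form, for an
orthonormal basis `e_i` of `T_x L`. -/
def normSqSecondFundamentalForm (cov : CovariantDerivative I E (TangentSpace I : M → Type _))
    (F : L → M) (x : L) : ℝ :=
  letI ε := stdOrthonormalBasis ℝ (TangentSpace I' x)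
  ∑ i, ∑ j, ‖secondFundamentalForm cov F x (ε i) (ε j)‖ ^ 2

variable (I') in
/-- The energy density `|∇a|² = ∑_d |∇a_d|²` of a map `a : L → ℝ³`. -/
def normSqGradient (a : L → EuclideanSpace ℝ (Fin 3)) (x : L) : ℝ :=
  letI ε := stdOrthonormalBasis ℝ (TangentSpace I' x)
  ∑ d : Fin 3, ∑ i, (mvfderiv I' (fun y : L => a y d) x (ε i)) ^ 2

variable (I I') in
/-- `F : L → M` is a smooth immersion and the metric of `L` is the induced one, `g = F^* ḡ`
(the injectivity of `dF` follows from `g = F^* ḡ`). -/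
structure IsIsometricImmersion (F : L → M) : Prop where
  contMDiff : ContMDiff I' I ∞ F
  inner_mfderiv (x : L) (u v : TangentSpace I' x) :
    inner ℝ (mfderiv I' I F x u) (mfderiv I' I F x v) = inner ℝ u v

end Along

/-! ### Hyperkähler manifolds -/

section Hyperkahler

variable {n : ℕ} {M : Type*} [TopologicalSpace M]
  [ChartedSpace (EuclideanSpace ℝ (Fin (4 * n))) M] [IsManifold (𝓡 (4 * n)) ∞ M]
  [RiemannianBundle (fun p : M => TangentSpace (𝓡 (4 * n)) p)]
  [IsContMDiffRiemannianBundle (𝓡 (4 * n)) ∞ (EuclideanSpace ℝ (Fin (4 * n)))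
    (fun p : M => TangentSpace (𝓡 (4 * n)) p)]

/-- `cov` is the Levi-Civita connection of the Riemannian manifold `M`: it is compatible with the
metric, `v⟨X, Y⟩ = ⟨∇_v X, Y⟩ + ⟨X, ∇_v Y⟩`, and torsion-free. -/
structure IsLeviCivita (cov : CovariantDerivative (𝓡 (4 * n)) (EuclideanSpace ℝ (Fin (4 * n)))
    (TangentSpace (𝓡 (4 * n)) : M → Type _)) : Prop where
  metric (p : M) (X Y : (q : M) → TangentSpace (𝓡 (4 * n)) q)
    (hX : MDifferentiableAt (𝓡 (4 * n)) (𝓡 (4 * n)).tangent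
      (fun q => (⟨q, X q⟩ : TangentBundle (𝓡 (4 * n)) M)) p)
    (hY : MDifferentiableAt (𝓡 (4 * n)) (𝓡 (4 * n)).tangent
      (fun q => (⟨q, Y q⟩ : TangentBundle (𝓡 (4 * n)) M)) p)
    (v : TangentSpace (𝓡 (4 * n)) p) :
    mvfderiv (𝓡 (4 * n)) (fun q => inner ℝ (X q) (Y q)) p v
      = inner ℝ (cov X p v) (Y p) + inner ℝ (X p) (cov Y p v)
  torsion_eq_zero : cov.torsion = 0

/-- `(J 0, J 1, J 2)` are the three complex structures `(J₁, J₂, J₃)` of a hyperkähler structure on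
the Riemannian manifold `M` with Levi-Civita connection `cov`: smooth endomorphism fields of `TM`
that are compatible with the metric, satisfy the quaternion relations, and are parallel (hence
integrable, and Kähler; equivalently the holonomy is contained in `Sp(n)`). -/
structure IsHyperkahler (cov : CovariantDerivative (𝓡 (4 * n)) (EuclideanSpace ℝ (Fin (4 * n)))
    (TangentSpace (𝓡 (4 * n)) : M → Type _))
    (J : Fin 3 → (p : M) → TangentSpace (𝓡 (4 * n)) p →L[ℝ] TangentSpace (𝓡 (4 * n)) p) :
    Prop where
  contMDiff (d : Fin 3) : ContMDiff (𝓡 (4 * n))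
    ((𝓡 (4 * n)).prod
      𝓘(ℝ, EuclideanSpace ℝ (Fin (4 * n)) →L[ℝ] EuclideanSpace ℝ (Fin (4 * n)))) ∞
    (fun p : M => Bundle.TotalSpace.mk'
      (EuclideanSpace ℝ (Fin (4 * n)) →L[ℝ] EuclideanSpace ℝ (Fin (4 * n)))
      (E := fun p : M => TangentSpace (𝓡 (4 * n)) p →L[ℝ] TangentSpace (𝓡 (4 * n)) p) p (J d p))
  isometric (d : Fin 3) (p : M) (u v : TangentSpace (𝓡 (4 * n)) p) :
    inner ℝ (J d p u) (J d p v) = inner ℝ u v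
  sq (d : Fin 3) (p : M) (u : TangentSpace (𝓡 (4 * n)) p) : J d p (J d p u) = -u
  quaternion (p : M) (u : TangentSpace (𝓡 (4 * n)) p) : J 0 p (J 1 p (J 2 p u)) = -u
  isLeviCivita : IsLeviCivita cov
  parallel (d : Fin 3) (p : M) (X : (q : M) → TangentSpace (𝓡 (4 * n)) q)
    (hX : MDifferentiableAt (𝓡 (4 * n)) (𝓡 (4 * n)).tangent
      (fun q => (⟨q, X q⟩ : TangentBundle (𝓡 (4 * n)) M)) p) (v : TangentSpace (𝓡 (4 * n)) p) :
    cov (fun q => J d q (X q)) p v = J d p (cov X p v)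

/-- The member `∑_d c_d J_d` of the twistor family, at the point `p`. -/
def twistor (J : Fin 3 → (p : M) → TangentSpace (𝓡 (4 * n)) p →L[ℝ] TangentSpace (𝓡 (4 * n)) p)
    (c : EuclideanSpace ℝ (Fin 3)) (p : M) :
    TangentSpace (𝓡 (4 * n)) p →L[ℝ] TangentSpace (𝓡 (4 * n)) p :=
  ∑ d : Fin 3, c d • J d p

/-- The holomorphic symplectic form `Ω = ω̄_{JK} - √-1 ω̄_K` of `J = ∑ c_d J_d`, written with an
element `K = ∑ k_d J_d` of the twistor family orthogonal to `J`; here `ω̄_K = ḡ(K ·, ·)`. -/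
def holSymplecticForm
    (J : Fin 3 → (p : M) → TangentSpace (𝓡 (4 * n)) p →L[ℝ] TangentSpace (𝓡 (4 * n)) p)
    (c k : EuclideanSpace ℝ (Fin 3)) (p : M) (u v : TangentSpace (𝓡 (4 * n)) p) : ℂ :=
  ((inner ℝ (twistor J c p (twistor J k p u)) v : ℝ) : ℂ)
    - Complex.I * ((inner ℝ (twistor J k p u) v : ℝ) : ℂ)

/-! ### Hyper-Lagrangian submanifolds -/

variable {L : Type*} [TopologicalSpace L]
  [ChartedSpace (EuclideanSpace ℝ (Fin (2 * n))) L] [IsManifold (𝓡 (2 * n)) ∞ L]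
  [RiemannianBundle (fun y : L => TangentSpace (𝓡 (2 * n)) y)]

/-- The `2n`-dimensional immersed submanifold `F : L → M` is hyper-Lagrangian with complex phase
`Ψ : L → S²`, where `Ψ` is given by its (smooth) coefficient vector `a : L → S² ⊆ ℝ³`:
`Ω_{Ψ(x)}` vanishes on `L` at every point `x`, whichever `K ∈ S²` orthogonal to `Ψ(x)` is used to
write `Ω_{Ψ(x)}` (a different `K` multiplies `Ω` by a unit complex number). -/
structure IsComplexPhase
    (J : Fin 3 → (p : M) → TangentSpace (𝓡 (4 * n)) p →L[ℝ] TangentSpace (𝓡 (4 * n)) p)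
    (F : L → M) (a : L → EuclideanSpace ℝ (Fin 3)) : Prop where
  contMDiff : ContMDiff (𝓡 (2 * n)) 𝓘(ℝ, EuclideanSpace ℝ (Fin 3)) ∞ a
  norm_eq_one (x : L) : ‖a x‖ = 1
  holSymplecticForm_eq_zero (x : L) (k : EuclideanSpace ℝ (Fin 3)) (hk : ‖k‖ = 1)
    (hak : inner ℝ (a x) k = 0) (u v : TangentSpace (𝓡 (2 * n)) x) :
    holSymplecticForm J (a x) k (F x) (mfderiv (𝓡 (2 * n)) (𝓡 (4 * n)) F x u)
      (mfderiv (𝓡 (2 * n)) (𝓡 (4 * n)) F x v) = 0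

/-- A canonical frame adapted to `(Ψ, Φ)` on the open set `U ⊆ L`. The maps `Ψ, Φ : L → S²` have
coefficient vectors `a` and `b`, with `Φ` smooth and pointwise orthogonal to `Ψ`. The smooth
orthonormal tangent frame `e_1, …, e_{2n}` is indexed by pairs: `e (ν, 0) = e_{2ν-1}` and
`e (ν, 1) = e_{2ν}`, and it satisfies `J_Ψ e_{2ν-1} = e_{2ν}`. The normal part of the frame is
`normalFrame J F b e`. -/
structure IsAdaptedFrame
    (J : Fin 3 → (p : M) → TangentSpace (𝓡 (4 * n)) p →L[ℝ] TangentSpace (𝓡 (4 * n)) p)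
    (F : L → M) (a b : L → EuclideanSpace ℝ (Fin 3))
    (e : Fin n × Fin 2 → (y : L) → TangentSpace (𝓡 (2 * n)) y) (U : Set L) : Prop where
  isOpen : IsOpen U
  contMDiffOn_phase : ContMDiffOn (𝓡 (2 * n)) 𝓘(ℝ, EuclideanSpace ℝ (Fin 3)) ∞ b U
  norm_phase (y : L) (hy : y ∈ U) : ‖b y‖ = 1
  phase_orthogonal (y : L) (hy : y ∈ U) : inner ℝ (a y) (b y) = 0
  contMDiffOn_frame (i : Fin n × Fin 2) : ContMDiffOn (𝓡 (2 * n)) (𝓡 (2 * n)).tangent ∞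
    (fun y => (⟨y, e i y⟩ : TangentBundle (𝓡 (2 * n)) L)) U
  orthonormal (y : L) (hy : y ∈ U) : Orthonormal ℝ (fun i => e i y)
  twistor_frame (y : L) (hy : y ∈ U) (ν : Fin n) :
    twistor J (a y) (F y) (mfderiv (𝓡 (2 * n)) (𝓡 (4 * n)) F y (e (ν, 0) y))
      = mfderiv (𝓡 (2 * n)) (𝓡 (4 * n)) F y (e (ν, 1) y)

/-- The normal part `e_{i+2n} = J_Φ e_i` of the canonical frame, indexed like the tangent frame:
for `μ = n + λ`, the vector `e_{2μ-1} = J_Φ e_{2λ-1}` has index `(λ, 0)` and `e_{2μ} = J_Φ e_{2λ}`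
has index `(λ, 1)`. -/
def normalFrame
    (J : Fin 3 → (p : M) → TangentSpace (𝓡 (4 * n)) p →L[ℝ] TangentSpace (𝓡 (4 * n)) p)
    (F : L → M) (b : L → EuclideanSpace ℝ (Fin 3))
    (e : Fin n × Fin 2 → (y : L) → TangentSpace (𝓡 (2 * n)) y) (α : Fin n × Fin 2) (y : L) :
    TangentSpace (𝓡 (4 * n)) (F y) :=
  twistor J (b y) (F y) (mfderiv (𝓡 (2 * n)) (𝓡 (4 * n)) F y (e α y))

/-- The coefficients `h^α_{ij} = ḡ(e_i, ∇̄_j e_α)` of the second fundamental form at `x`. -/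
def coeffSecondFundamentalForm
    (cov : CovariantDerivative (𝓡 (4 * n)) (EuclideanSpace ℝ (Fin (4 * n)))
      (TangentSpace (𝓡 (4 * n)) : M → Type _))
    (J : Fin 3 → (p : M) → TangentSpace (𝓡 (4 * n)) p →L[ℝ] TangentSpace (𝓡 (4 * n)) p)
    (F : L → M) (b : L → EuclideanSpace ℝ (Fin 3))
    (e : Fin n × Fin 2 → (y : L) → TangentSpace (𝓡 (2 * n)) y) (x : L)
    (α i j : Fin n × Fin 2) : ℝ :=
  inner ℝ (mfderiv (𝓡 (2 * n)) (𝓡 (4 * n)) F x (e i x))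
    (covAlong cov F (normalFrame J F b e α) x (e j x))

end Hyperkahler

end HyperLagrangian

end

universe u v

open HyperLagrangian

noncomputable section

namespace HyperLagrangian

open Filter Topology

/-! ### Calculus of covariant derivatives along a map -/

section AlongCalculus

variable {E : Type*} [NormedAddCommGroup E] [NormedSpace ℝ E]
  {H : Type*} [TopologicalSpace H] {I : ModelWithCorners ℝ E H}
  {M : Type*} [TopologicalSpace M] [ChartedSpace H M] [IsManifold I 1 M]
  {E' : Type*} [NormedAddCommGroup E'] [NormedSpace ℝ E']
  {H' : Type*} [TopologicalSpace H'] {I' : ModelWithCorners ℝ E' H'}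
  {L : Type*} [TopologicalSpace L] [ChartedSpace H' L]
  {F : L → M} {x : L}

/-! Both parts rest on one computation. The `J_d` are parallel along maps
(`IsHyperkahler.covAlong_apply`), so with `s = da(v)` the Leibniz rule gives `∇̄_v J_Ψ = J_s`. Since
`|J_s w| = |s| |w|`, it follows that `|∇̄J_Ψ|² = 4n ∑ᵢ |da(eᵢ)|² = 4n |∇a|²`. Moreover `s ⊥ a`,
because `|a| = 1`.

For the frame formula, `e_{2μ} = -J_Ψ e_{2μ-1}` on the normal side, because `J_Φ` and `J_Ψ`
anticommute. Differentiating this and pairing with a tangent vector, the terms containing `J_Ψ ∇̄_v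
e_{2μ-1}` cancel in each bracket. What remains is a pairing with `J_s J_Φ e = -⟨s, b⟩ e + J_{s × b}
e`, where `s × b = ρ a`. So the brackets vanish for different pairs `ν`, `μ` and equal `-⟨s, b⟩` and
`-ρ` for matching ones. As `⟨s, b⟩² + ρ² = |s|²`, each direction contributes `n |s|²`
(`IsAdaptedFrame.sum_coeffSecondFundamentalForm`).

The estimate uses no adapted frame. For `k ⊥ a`, `J_k` sends tangent vectors to normal ones.
Differentiating `⟨J_b W, Z⟩ = 0`, for a field `b ⊥ a` with `b(x) = s`, yields `|s|² ⟨J_Ψ w, z⟩ =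
⟨J_s w, A(v, z)⟩ - ⟨A(v, w), J_s z⟩` (`IsComplexPhase.norm_sq_mul_inner_twistor`). A dimension count
shows that `J_Ψ` preserves the tangent space, so squaring and summing over an orthonormal basis
bounds `|s|²` by `4 ∑ⱼ |A(v, εⱼ)|²`. -/

variable (I I' F) in
/-- Differentiability at `x` of a vector field `V` along `F : L → M`. -/
def MDiffAlong (V : (y : L) → TangentSpace I (F y)) (x : L) : Prop :=
  MDifferentiableAt I' I.tangent (fun y : L => (⟨F y, V y⟩ : TangentBundle I M)) x

variable (I F) in
/-- The coefficients of a vector field along `F` in the coordinate frame at `F x`. -/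
def alongCoord (x : L) (V : (y : L) → TangentSpace I (F y)) (y : L) : E :=
  (trivializationAt E (TangentSpace I : M → Type _) (F x) (⟨F y, V y⟩ : TangentBundle I M)).2

lemma mdiffAlong_iff {V : (y : L) → TangentSpace I (F y)} :
    MDiffAlong I I' F V x ↔
      MDifferentiableAt I' I F x ∧ MDifferentiableAt I' 𝓘(ℝ, E) (alongCoord I F x V) x :=
  mdifferentiableAt_totalSpace _ _

lemma MDiffAlong.mdifferentiableAt {V : (y : L) → TangentSpace I (F y)}
    (hV : MDiffAlong I I' F V x) : MDifferentiableAt I' I F x :=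
  (mdiffAlong_iff.1 hV).1

lemma MDiffAlong.congr {V W : (y : L) → TangentSpace I (F y)} (hV : MDiffAlong I I' F V x)
    (h : ∀ᶠ y in 𝓝 x, V y = W y) : MDiffAlong I I' F W x :=
  MDifferentiableAt.congr_of_eventuallyEq hV (h.mono fun y hy => by simp only [hy])

lemma MDiffAlong.eventually_mem {V : (y : L) → TangentSpace I (F y)}
    (hV : MDiffAlong I I' F V x) :
    ∀ᶠ y in 𝓝 x, F y ∈ (trivializationAt E (TangentSpace I : M → Type _) (F x)).baseSet :=
  hV.mdifferentiableAt.continuousAt.preimage_mem_nhds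
    ((Trivialization.open_baseSet _).mem_nhds (FiberBundle.mem_baseSet_trivializationAt' _))

lemma alongCoord_add {N : Type*} {F : N → M} {x : N} {V W : (y : N) → TangentSpace I (F y)}
    {y : N}
    (hy : F y ∈ (trivializationAt E (TangentSpace I : M → Type _) (F x)).baseSet) :
    alongCoord I F x (V + W) y = alongCoord I F x V y + alongCoord I F x W y :=
  ((trivializationAt E (TangentSpace I : M → Type _) (F x)).linear ℝ hy).1 _ _

lemma alongCoord_smul {N : Type*} {F : N → M} {x : N} {V : (y : N) → TangentSpace I (F y)}
    {f : N → ℝ} {y : N}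
    (hy : F y ∈ (trivializationAt E (TangentSpace I : M → Type _) (F x)).baseSet) :
    alongCoord I F x (f • V) y = f y • alongCoord I F x V y :=
  ((trivializationAt E (TangentSpace I : M → Type _) (F x)).linear ℝ hy).2 _ _

lemma MDiffAlong.add {V W : (y : L) → TangentSpace I (F y)} (hV : MDiffAlong I I' F V x)
    (hW : MDiffAlong I I' F W x) : MDiffAlong I I' F (V + W) x := by
  refine mdiffAlong_iff.2 ⟨hV.mdifferentiableAt, ?_⟩
  exact ((mdiffAlong_iff.1 hV).2.add (mdiffAlong_iff.1 hW).2).congr_of_eventuallyEq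
    (hV.eventually_mem.mono fun y hy => alongCoord_add hy)

lemma MDiffAlong.smul {V : (y : L) → TangentSpace I (F y)} {f : L → ℝ}
    (hf : MDifferentiableAt I' 𝓘(ℝ) f x) (hV : MDiffAlong I I' F V x) :
    MDiffAlong I I' F (f • V) x := by
  refine mdiffAlong_iff.2 ⟨hV.mdifferentiableAt, ?_⟩
  exact (hf.smul (mdiffAlong_iff.1 hV).2).congr_of_eventuallyEq
    (hV.eventually_mem.mono fun y hy => alongCoord_smul hy)

lemma mdiffAlong_comp {X : (p : M) → TangentSpace I p} (hF : MDifferentiableAt I' I F x)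
    (hX : MDifferentiableAt I I.tangent (fun p => (⟨p, X p⟩ : TangentBundle I M)) (F x)) :
    MDiffAlong I I' F (fun y => X (F y)) x :=
  MDifferentiableAt.comp x hX hF

/-- Constant-coefficient extension is fibrewise linear in the trivialization at `p`; the argument is
made on its base set, and a germ is all that a connection sees. -/
lemma extend_add (p : M) (u w : TangentSpace I p) :
    ∀ᶠ q in 𝓝 p, FiberBundle.extend E (u + w) q
      = FiberBundle.extend E u q + FiberBundle.extend E w q := by
  have hp := FiberBundle.mem_baseSet_trivializationAt' (F := E)
    (E := (TangentSpace I : M → Type _)) p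
  filter_upwards [(Trivialization.open_baseSet _).mem_nhds hp] with q hq
  simp only [FiberBundle.extend]
  rw [((trivializationAt E (TangentSpace I : M → Type _) p).linear ℝ hp).1,
    ← Trivialization.symmL_apply (R := ℝ) _ hq, map_add, Trivialization.symmL_apply (R := ℝ) _ hq,
    Trivialization.symmL_apply (R := ℝ) _ hq]

lemma extend_smul (p : M) (c : ℝ) (u : TangentSpace I p) :
    ∀ᶠ q in 𝓝 p, FiberBundle.extend E (c • u) q = c • FiberBundle.extend E u q := by
  have hp := FiberBundle.mem_baseSet_trivializationAt' (F := E)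
    (E := (TangentSpace I : M → Type _)) p
  filter_upwards [(Trivialization.open_baseSet _).mem_nhds hp] with q hq
  simp only [FiberBundle.extend]
  rw [((trivializationAt E (TangentSpace I : M → Type _) p).linear ℝ hp).2,
    ← Trivialization.symmL_apply (R := ℝ) _ hq, map_smul, Trivialization.symmL_apply (R := ℝ) _ hq]

lemma mdifferentiableAt_extend_tangent (p : M) (u : TangentSpace I p) :
    MDifferentiableAt I I.tangent
      (fun q => (⟨q, FiberBundle.extend E u q⟩ : TangentBundle I M)) p :=
  FiberBundle.mdifferentiableAt_extend I E u

variable (cov : CovariantDerivative I E (TangentSpace I : M → Type _))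

lemma cov_extend_add (p : M) (u w : TangentSpace I p) :
    cov (FiberBundle.extend E (u + w)) p
      = cov (FiberBundle.extend E u) p + cov (FiberBundle.extend E w) p := by
  have hu := mdifferentiableAt_extend_tangent (I := I) p u
  have hw := mdifferentiableAt_extend_tangent (I := I) p w
  rw [← cov.isCovariantDerivativeOnUniv.add hu hw]
  exact cov.isCovariantDerivativeOnUniv.congr_of_eventuallyEq
    (mdifferentiableAt_extend_tangent p _) (mdifferentiableAt_add_section hu hw) univ_mem
    (extend_add p u w)

lemma cov_extend_smul (p : M) (c : ℝ) (u : TangentSpace I p) :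
    cov (FiberBundle.extend E (c • u)) p = c • cov (FiberBundle.extend E u) p := by
  have hu := mdifferentiableAt_extend_tangent (I := I) p u
  rw [← cov.isCovariantDerivativeOnUniv.smul_const c hu]
  exact cov.isCovariantDerivativeOnUniv.congr_of_eventuallyEq
    (mdifferentiableAt_extend_tangent p _) hu.smul_const_section univ_mem
    (extend_smul p c u)

lemma symmL_alongCoord {N : Type*} {F : N → M} {x : N} (V : (y : N) → TangentSpace I (F y)) :
    (trivializationAt E (TangentSpace I : M → Type _) (F x)).symmL ℝ (F x)
      (alongCoord I F x V x) = V x := by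
  have hp := FiberBundle.mem_baseSet_trivializationAt' (F := E)
    (E := (TangentSpace I : M → Type _)) (F x)
  rw [Trivialization.symmL_apply _ hp]
  exact Trivialization.symm_apply_apply_mk _ hp _

lemma mvfderiv_congr {G : Type*} [NormedAddCommGroup G] [NormedSpace ℝ G] {f g : L → G}
    (h : f =ᶠ[𝓝 x] g) (v : TangentSpace I' x) : mvfderiv I' f x v = mvfderiv I' g x v := by
  simp only [mvfderiv, h.mfderiv_eq]
  rfl

lemma covAlong_apply (V : (y : L) → TangentSpace I (F y)) (v : TangentSpace I' x) :
    covAlong cov F V x v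
      = (trivializationAt E (TangentSpace I : M → Type _) (F x)).symmL ℝ (F x)
          (mvfderiv I' (alongCoord I F x V) x v)
        + cov (FiberBundle.extend E (V x)) (F x) (mfderiv I' I F x v) :=
  rfl

lemma covAlong_congr {V W : (y : L) → TangentSpace I (F y)} (h : ∀ᶠ y in 𝓝 x, V y = W y)
    (v : TangentSpace I' x) : covAlong cov F V x v = covAlong cov F W x v := by
  have h' : alongCoord I F x V =ᶠ[𝓝 x] alongCoord I F x W :=
    h.mono fun y hy => by simp only [alongCoord, hy]
  rw [covAlong_apply, covAlong_apply, mvfderiv_congr h', h.self_of_nhds]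

lemma covAlong_add {V W : (y : L) → TangentSpace I (F y)} (hV : MDiffAlong I I' F V x)
    (hW : MDiffAlong I I' F W x) (v : TangentSpace I' x) :
    covAlong cov F (V + W) x v = covAlong cov F V x v + covAlong cov F W x v := by
  have h := mvfderiv_congr (I' := I')
    (hV.eventually_mem.mono fun y hy => alongCoord_add (V := V) (W := W) hy) v
  simp only [covAlong_apply, h, Pi.add_apply, cov_extend_add]
  rw [mvfderiv_fun_add (mdiffAlong_iff.1 hV).2 (mdiffAlong_iff.1 hW).2]
  simp only [_root_.add_apply, map_add]
  abel

/-- The derivative of the coefficients produces both terms of the ordinary product rule; the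
connection term depends only on `V x`, linearly, so it is just multiplied by `f x`. -/
lemma covAlong_smul {V : (y : L) → TangentSpace I (F y)} {f : L → ℝ}
    (hf : MDifferentiableAt I' 𝓘(ℝ) f x) (hV : MDiffAlong I I' F V x) (v : TangentSpace I' x) :
    covAlong cov F (f • V) x v = mvfderiv I' f x v • V x + f x • covAlong cov F V x v := by
  have h := mvfderiv_congr (I' := I')
    (hV.eventually_mem.mono fun y hy => alongCoord_smul (V := V) (f := f) hy) v
  simp only [covAlong_apply, h, Pi.smul_apply', cov_extend_smul]
  rw [mvfderiv_fun_smul hf (mdiffAlong_iff.1 hV).2]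
  simp only [_root_.add_apply, _root_.smul_apply,
    ContinuousLinearMap.smulRight_apply, map_add, map_smul, symmL_alongCoord, smul_add]
  abel

lemma alongCoord_extend {N : Type*} {F : N → M} {x : N} (u : TangentSpace I (F x)) {y : N}
    (hy : F y ∈ (trivializationAt E (TangentSpace I : M → Type _) (F x)).baseSet) :
    alongCoord I F x (fun y => FiberBundle.extend E u (F y)) y
      = (trivializationAt E (TangentSpace I : M → Type _) (F x)
          (⟨F x, u⟩ : TangentBundle I M)).2 := by
  simp only [alongCoord, FiberBundle.extend]
  rw [Trivialization.apply_mk_symm _ hy]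

lemma mdiffAlong_extend (hF : MDifferentiableAt I' I F x) (u : TangentSpace I (F x)) :
    MDiffAlong I I' F (fun y => FiberBundle.extend E u (F y)) x :=
  mdiffAlong_comp hF (mdifferentiableAt_extend_tangent _ u)

lemma covAlong_extend (hF : MDifferentiableAt I' I F x) (u : TangentSpace I (F x))
    (v : TangentSpace I' x) :
    covAlong cov F (fun y => FiberBundle.extend E u (F y)) x v
      = cov (FiberBundle.extend E u) (F x) (mfderiv I' I F x v) := by
  rw [covAlong_apply, mvfderiv_congr ((mdiffAlong_extend hF u).eventually_mem.mono fun y hy =>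
    alongCoord_extend u hy), mvfderiv_const]
  simp

/-- A property of vector fields along `F` that is local and stable under sums and products with
functions holds for all differentiable fields if it holds for the constant-coefficient ones. -/
theorem MDiffAlong.induction [FiniteDimensional ℝ E]
    {P : ((y : L) → TangentSpace I (F y)) → Prop}
    (congr : ∀ V W, MDiffAlong I I' F V x → (∀ᶠ y in 𝓝 x, V y = W y) → P V → P W)
    (add : ∀ V W, MDiffAlong I I' F V x → MDiffAlong I I' F W x → P V → P W → P (V + W))
    (smul : ∀ (f : L → ℝ) V, MDifferentiableAt I' 𝓘(ℝ) f x → MDiffAlong I I' F V x → P V →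
      P (f • V))
    (extend : ∀ u : TangentSpace I (F x), P (fun y => FiberBundle.extend E u (F y)))
    {V : (y : L) → TangentSpace I (F y)} (hV : MDiffAlong I I' F V x) : P V := by
  classical
  have hF := hV.mdifferentiableAt
  let t := trivializationAt E (TangentSpace I : M → Type _) (F x)
  have hp : F x ∈ t.baseSet := FiberBundle.mem_baseSet_trivializationAt' _
  let β := Module.finBasis ℝ E
  let f : Fin (Module.finrank ℝ E) → L → ℝ := fun k y => β.repr (alongCoord I F x V y) k
  let D : Fin (Module.finrank ℝ E) → (y : L) → TangentSpace I (F y) :=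
    fun k y => FiberBundle.extend E (t.symmL ℝ (F x) (β k)) (F y)
  have hf : ∀ k, MDifferentiableAt I' 𝓘(ℝ) (f k) x := fun k =>
    ((LinearMap.toContinuousLinearMap (β.coord k)).mdifferentiableAt).comp x
      (mdiffAlong_iff.1 hV).2
  have hD : ∀ k, MDiffAlong I I' F (D k) x := fun k => mdiffAlong_extend hF _
  have key : ∀ s : Finset (Fin (Module.finrank ℝ E)),
      MDiffAlong I I' F (∑ k ∈ s, f k • D k) x ∧ P (∑ k ∈ s, f k • D k) := by
    intro s
    induction s using Finset.induction_on with
    | empty =>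
      -- The zero field is written as the zero function times a constant-coefficient field, so the
      -- induction principle needs no separate base case.
      have h0 := mdiffAlong_extend hF (0 : TangentSpace I (F x))
      have hz : (fun _ => 0 : L → ℝ) • (fun y => FiberBundle.extend E
          (0 : TangentSpace I (F x)) (F y)) = (0 : (y : L) → TangentSpace I (F y)) := by
        ext y
        simp
      rw [Finset.sum_empty, ← hz]
      exact ⟨.smul mdifferentiableAt_const h0, smul _ _ mdifferentiableAt_const h0 (extend 0)⟩
    | insert k s hk ih =>
      rw [Finset.sum_insert hk]
      have hk' := MDiffAlong.smul (hf k) (hD k)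
      exact ⟨hk'.add ih.1, add _ _ hk' ih.1 (smul _ _ (hf k) (hD k) (extend _)) ih.2⟩
  -- The expansion of `V` in the coordinate frame is valid only where `F y` stays in the base set,
  -- hence the appeal to locality.
  refine congr _ _ (key Finset.univ).1 ?_ (key Finset.univ).2
  filter_upwards [hV.eventually_mem] with y hy
  have hDy : ∀ k, D k y = t.symmL ℝ (F y) (β k) := by
    intro k
    simp only [D, FiberBundle.extend]
    rw [Trivialization.symmL_apply _ hp, Trivialization.symmL_apply _ hy,
      Trivialization.apply_mk_symm _ hp]
  rw [Finset.sum_apply]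
  simp only [Pi.smul_apply', hDy, ← map_smul]
  rw [← map_sum, β.sum_repr, Trivialization.symmL_apply _ hy]
  exact Trivialization.symm_apply_apply_mk _ hy _

/-- Both sides are local, additive and satisfy the same Leibniz rule, so it suffices to compare them
on constant-coefficient fields, where the coefficient derivative vanishes. -/
lemma cov_eq_covAlong_id [FiniteDimensional ℝ E] {p : M} {X : (p : M) → TangentSpace I p}
    (hX : MDiffAlong I I id X p) (v : TangentSpace I p) :
    cov X p v = covAlong cov id X p v := by
  refine MDiffAlong.induction (F := (id : M → M)) (x := p)
    (P := fun X : (p : M) → TangentSpace I p => cov X p v = covAlong cov id X p v)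
    ?_ ?_ ?_ ?_ hX
  · intro V W hV h hP
    rw [← covAlong_congr cov h, ← hP]
    exact congrArg (fun T => T v) (cov.isCovariantDerivativeOnUniv.congr_of_eventuallyEq
      (hV.congr h) hV univ_mem (h.mono fun y hy => hy.symm))
  · intro V W hV hW hPV hPW
    rw [covAlong_add cov hV hW, ← hPV, ← hPW]
    exact congrArg (fun T => T v) (cov.isCovariantDerivativeOnUniv.add hV hW)
  · intro f V hf hV hP
    rw [covAlong_smul cov hf hV, ← hP, add_comm]
    exact congrArg (fun T => T v) (cov.isCovariantDerivativeOnUniv.leibniz hV hf)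
  · intro u
    refine Eq.trans ?_ (covAlong_extend cov mdifferentiableAt_id u v).symm
    rw [mfderiv_id]
    rfl

/-- The coordinates of `X ∘ F` are those of `X` composed with `F`, so the chain rule reduces this to
the identity map. -/
lemma covAlong_comp [FiniteDimensional ℝ E] {X : (p : M) → TangentSpace I p}
    (hF : MDifferentiableAt I' I F x)
    (hX : MDifferentiableAt I I.tangent (fun p => (⟨p, X p⟩ : TangentBundle I M)) (F x))
    (v : TangentSpace I' x) :
    covAlong cov F (fun y => X (F y)) x v = cov X (F x) (mfderiv I' I F x v) := by
  rw [cov_eq_covAlong_id cov hX, covAlong_apply, covAlong_apply, mfderiv_id]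
  have h : mvfderiv I' (alongCoord I F x fun y => X (F y)) x v
      = mvfderiv I (alongCoord I id (F x) X) (F x) (mfderiv I' I F x v) :=
    congrArg (fun T => T v) (mfderiv_comp x (mdiffAlong_iff.1 hX).2 hF)
  rw [h]
  rfl

end AlongCalculus

/-! ### Quaternionic algebra of the twistor family. -/

section TwistorAlgebra

/-- The cross product on Euclidean `ℝ³`. -/
def cross (c d : EuclideanSpace ℝ (Fin 3)) : EuclideanSpace ℝ (Fin 3) :=
  !₂[c 1 * d 2 - c 2 * d 1, c 2 * d 0 - c 0 * d 2, c 0 * d 1 - c 1 * d 0]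

lemma inner_fin_three (c d : EuclideanSpace ℝ (Fin 3)) :
    inner ℝ c d = c 0 * d 0 + c 1 * d 1 + c 2 * d 2 := by
  simp [PiLp.inner_apply, Fin.sum_univ_three]
  ring

lemma inner_cross_self_right (c d : EuclideanSpace ℝ (Fin 3)) : inner ℝ d (cross c d) = 0 := by
  simp [inner_fin_three, cross]
  ring

/-- If `a` is a unit vector orthogonal to `s` and `b`, then `s × b` is a multiple of `a`. -/
lemma cross_eq_smul {a b s : EuclideanSpace ℝ (Fin 3)} (ha : inner ℝ a a = (1 : ℝ))
    (hb : inner ℝ a b = (0 : ℝ)) (hs : inner ℝ a s = (0 : ℝ)) :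
    cross s b = (inner ℝ a (cross s b) : ℝ) • a := by
  rw [inner_fin_three] at ha hb hs
  ext i
  fin_cases i <;> simp [cross, inner_fin_three]
  -- With `w = s × b`, the coefficients come from `⟨a, w⟩ a - |a|² w = a × (a × w)` and `a × w = ⟨a,
  -- b⟩ s - ⟨a, s⟩ b`, read off component by component.
  · linear_combination (-(s 1 * b 2 - s 2 * b 1)) * ha
      + (a 1 * s 2 - a 2 * s 1) * hb * (-1) + (a 1 * b 2 - a 2 * b 1) * hs
  · linear_combination (-(s 2 * b 0 - s 0 * b 2)) * ha
      + (a 2 * s 0 - a 0 * s 2) * hb * (-1) + (a 2 * b 0 - a 0 * b 2) * hs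
  · linear_combination (-(s 0 * b 1 - s 1 * b 0)) * ha
      + (a 0 * s 1 - a 1 * s 0) * hb * (-1) + (a 0 * b 1 - a 1 * b 0) * hs

/-- Lagrange's identity. -/
lemma inner_cross_cross (s b : EuclideanSpace ℝ (Fin 3)) :
    (inner ℝ (cross s b) (cross s b) : ℝ) + (inner ℝ s b : ℝ) ^ 2
      = inner ℝ s s * inner ℝ b b := by
  simp only [inner_fin_three]
  simp [cross]
  ring

section

variable {n : ℕ} {M : Type*} [TopologicalSpace M]
  [ChartedSpace (EuclideanSpace ℝ (Fin (4 * n))) M]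
  {J : Fin 3 → (p : M) → TangentSpace (𝓡 (4 * n)) p →L[ℝ] TangentSpace (𝓡 (4 * n)) p}
  {p : M}

lemma twistor_apply (c : EuclideanSpace ℝ (Fin 3)) (u : TangentSpace (𝓡 (4 * n)) p) :
    twistor J c p u = c 0 • J 0 p u + c 1 • J 1 p u + c 2 • J 2 p u := by
  simp [twistor, Fin.sum_univ_three]

lemma twistor_smul (r : ℝ) (c : EuclideanSpace ℝ (Fin 3)) (u : TangentSpace (𝓡 (4 * n)) p) :
    twistor J (r • c) p u = r • twistor J c p u := by
  simp only [twistor_apply, PiLp.smul_apply, smul_eq_mul]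
  module

lemma twistor_zero (u : TangentSpace (𝓡 (4 * n)) p) : twistor J 0 p u = 0 := by
  simp [twistor_apply]

end

variable {n : ℕ} {M : Type*} [TopologicalSpace M]
  [ChartedSpace (EuclideanSpace ℝ (Fin (4 * n))) M] [IsManifold (𝓡 (4 * n)) ∞ M]
  [RiemannianBundle (fun p : M => TangentSpace (𝓡 (4 * n)) p)]
  {cov : CovariantDerivative (𝓡 (4 * n)) (EuclideanSpace ℝ (Fin (4 * n)))
    (TangentSpace (𝓡 (4 * n)) : M → Type _)}
  {J : Fin 3 → (p : M) → TangentSpace (𝓡 (4 * n)) p →L[ℝ] TangentSpace (𝓡 (4 * n)) p}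
  {p : M}

lemma IsHyperkahler.inner_left (hJ : IsHyperkahler cov J) (d : Fin 3)
    (u w : TangentSpace (𝓡 (4 * n)) p) :
    (inner ℝ (J d p u) w : ℝ) = -inner ℝ u (J d p w) := by
  rw [← hJ.isometric d p u, hJ.sq, inner_neg_right, neg_neg]

/-- This is the product of imaginary quaternions: minus the scalar product plus the cross product.
-/
lemma IsHyperkahler.twistor_twistor (hJ : IsHyperkahler cov J)
    (c d : EuclideanSpace ℝ (Fin 3)) (u : TangentSpace (𝓡 (4 * n)) p) :
    twistor J c p (twistor J d p u) = -(inner ℝ c d : ℝ) • u + twistor J (cross c d) p u := by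
  -- The relation `J₁J₂J₃ = -1` and `J_d² = -1` determine the six mixed products.
  have h01 : ∀ w, J 0 p (J 1 p w) = J 2 p w := fun w => by
    have := hJ.quaternion p (J 2 p w)
    rw [hJ.sq, map_neg, map_neg, neg_inj] at this
    exact this
  have h12 : ∀ w, J 1 p (J 2 p w) = J 0 p w := fun w => by
    have := congrArg (J 0 p) (hJ.quaternion p w)
    rw [hJ.sq, map_neg, neg_inj] at this
    exact this
  have h20 : ∀ w, J 2 p (J 0 p w) = J 1 p w := fun w => by
    have := congrArg (J 1 p) (h12 (J 0 p w))
    rw [hJ.sq, hJ.sq, map_neg, neg_inj] at this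
    exact this
  have h10 : ∀ w, J 1 p (J 0 p w) = -J 2 p w := fun w => by
    rw [← h12 w, hJ.sq]
  have h21 : ∀ w, J 2 p (J 1 p w) = -J 0 p w := fun w => by
    rw [← h20 w, hJ.sq]
  have h02 : ∀ w, J 0 p (J 2 p w) = -J 1 p w := fun w => by
    rw [← h01 w, hJ.sq]
  simp only [twistor_apply, inner_fin_three, map_add, map_smul, hJ.sq, h01, h12, h20, h10, h21,
    h02, cross]
  simp
  module

lemma IsHyperkahler.inner_twistor_left (hJ : IsHyperkahler cov J) (c : EuclideanSpace ℝ (Fin 3))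
    (u w : TangentSpace (𝓡 (4 * n)) p) :
    (inner ℝ (twistor J c p u) w : ℝ) = -inner ℝ u (twistor J c p w) := by
  simp only [twistor_apply, inner_add_left, inner_add_right, inner_smul_left, inner_smul_right,
    hJ.inner_left]
  simp
  ring

lemma cross_self (c : EuclideanSpace ℝ (Fin 3)) : cross c c = 0 := by
  ext i
  fin_cases i <;> simp [cross] <;> ring

lemma IsHyperkahler.inner_twistor_twistor (hJ : IsHyperkahler cov J)
    (c : EuclideanSpace ℝ (Fin 3)) (u w : TangentSpace (𝓡 (4 * n)) p) :
    (inner ℝ (twistor J c p u) (twistor J c p w) : ℝ) = inner ℝ c c * inner ℝ u w := by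
  rw [hJ.inner_twistor_left, hJ.twistor_twistor, cross_self, twistor_zero, add_zero,
    inner_smul_right]
  ring

end TwistorAlgebra

/-! ### Parallelism and metric compatibility along a map. -/

section HyperkahlerAlong

variable {n : ℕ} {M : Type*} [TopologicalSpace M]
  [ChartedSpace (EuclideanSpace ℝ (Fin (4 * n))) M] [IsManifold (𝓡 (4 * n)) ∞ M]
  [RiemannianBundle (fun p : M => TangentSpace (𝓡 (4 * n)) p)]
  {cov : CovariantDerivative (𝓡 (4 * n)) (EuclideanSpace ℝ (Fin (4 * n)))
    (TangentSpace (𝓡 (4 * n)) : M → Type _)}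
  {J : Fin 3 → (p : M) → TangentSpace (𝓡 (4 * n)) p →L[ℝ] TangentSpace (𝓡 (4 * n)) p}
  {E' : Type*} [NormedAddCommGroup E'] [NormedSpace ℝ E']
  {H' : Type*} [TopologicalSpace H'] {I' : ModelWithCorners ℝ E' H'}
  {L : Type*} [TopologicalSpace L] [ChartedSpace H' L]
  {F : L → M} {x : L} {V W : (y : L) → TangentSpace (𝓡 (4 * n)) (F y)}

lemma IsHyperkahler.mdiffAlong (hJ : IsHyperkahler cov J) (d : Fin 3)
    (hV : MDiffAlong (𝓡 (4 * n)) I' F V x) :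
    MDiffAlong (𝓡 (4 * n)) I' F (fun y => J d (F y) (V y)) x :=
  MDifferentiableAt.clm_bundle_apply
    (MDifferentiableAt.comp x ((hJ.contMDiff d).mdifferentiable (by simp) (F x))
      hV.mdifferentiableAt) hV

/-- The complex structures of a hyperkähler manifold are parallel along maps. -/
theorem IsHyperkahler.covAlong_apply (hJ : IsHyperkahler cov J) (d : Fin 3)
    (hV : MDiffAlong (𝓡 (4 * n)) I' F V x) (v : TangentSpace I' x) :
    covAlong cov F (fun y => J d (F y) (V y)) x v = J d (F x) (covAlong cov F V x v) := by
  have hF := hV.mdifferentiableAt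
  refine MDiffAlong.induction (V := V) (P := fun V =>
    covAlong cov F (fun y => J d (F y) (V y)) x v = J d (F x) (covAlong cov F V x v))
    ?_ ?_ ?_ ?_ hV
  · intro V V' hV h hP
    rw [← covAlong_congr cov h, ← hP]
    exact covAlong_congr cov (h.mono fun y hy => by simp only [hy]) v
  · intro V V' hV hV' hP hP'
    rw [covAlong_add cov hV hV', map_add, ← hP, ← hP',
      ← covAlong_add cov (hJ.mdiffAlong d hV) (hJ.mdiffAlong d hV')]
    exact covAlong_congr cov (.of_forall fun y => map_add _ _ _) v
  · intro f V hf hV hP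
    rw [covAlong_smul cov hf hV, map_add, map_smul, map_smul, ← hP,
      ← covAlong_smul cov hf (hJ.mdiffAlong d hV)]
    exact covAlong_congr cov (W := f • fun y => J d (F y) (V y))
      (.of_forall fun y => (J d (F y)).map_smul (f y) (V y)) v
  -- A constant-coefficient field is pulled back from `M`, so parallelism on `M` applies directly.
  · intro u
    have hu := mdifferentiableAt_extend_tangent (I := 𝓡 (4 * n)) (F x) u
    have hJu := hJ.mdiffAlong d (F := (id : M → M)) (I' := 𝓡 (4 * n)) hu
    rw [covAlong_extend cov hF u]
    exact (covAlong_comp (X := fun p => J d p (FiberBundle.extend _ u p)) cov hF hJu v).trans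
      (hJ.parallel d _ _ hu _)

variable {a : L → EuclideanSpace ℝ (Fin 3)}

lemma mdifferentiableAt_apply (ha : MDifferentiableAt I' 𝓘(ℝ, EuclideanSpace ℝ (Fin 3)) a x)
    (d : Fin 3) : MDifferentiableAt I' 𝓘(ℝ) (fun y => a y d) x :=
  ((EuclideanSpace.proj d : EuclideanSpace ℝ (Fin 3) →L[ℝ] ℝ).mdifferentiableAt).comp x ha

lemma mvfderiv_apply (ha : MDifferentiableAt I' 𝓘(ℝ, EuclideanSpace ℝ (Fin 3)) a x)
    (d : Fin 3) (v : TangentSpace I' x) :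
    mvfderiv I' (fun y => a y d) x v = (mvfderiv I' a x v) d := by
  have h := mfderiv_comp x
    ((EuclideanSpace.proj d : EuclideanSpace ℝ (Fin 3) →L[ℝ] ℝ).mdifferentiableAt) ha
  rw [ContinuousLinearMap.mfderiv_eq] at h
  exact congrArg (fun T => T v) h

lemma IsHyperkahler.mdiffAlong_twistor (hJ : IsHyperkahler cov J)
    (ha : MDifferentiableAt I' 𝓘(ℝ, EuclideanSpace ℝ (Fin 3)) a x)
    (hV : MDiffAlong (𝓡 (4 * n)) I' F V x) :
    MDiffAlong (𝓡 (4 * n)) I' F (fun y => twistor J (a y) (F y) (V y)) x :=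
  have h := fun d => MDiffAlong.smul (mdifferentiableAt_apply ha d) (hJ.mdiffAlong d hV)
  (((h 0).add (h 1)).add (h 2)).congr (.of_forall fun _ => (twistor_apply _ _).symm)

/-- The Leibniz rule for the twistor family. -/
theorem IsHyperkahler.covAlong_twistor (hJ : IsHyperkahler cov J)
    (ha : MDifferentiableAt I' 𝓘(ℝ, EuclideanSpace ℝ (Fin 3)) a x)
    (hV : MDiffAlong (𝓡 (4 * n)) I' F V x) (v : TangentSpace I' x) :
    covAlong cov F (fun y => twistor J (a y) (F y) (V y)) x v
      = twistor J (mvfderiv I' a x v) (F x) (V x)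
        + twistor J (a x) (F x) (covAlong cov F V x v) := by
  have ha' := mdifferentiableAt_apply ha
  have hJV := fun d => hJ.mdiffAlong d hV
  have h := fun d => MDiffAlong.smul (ha' d) (hJV d)
  rw [covAlong_congr cov (W := ((fun y => a y 0) • (fun y => J 0 (F y) (V y))
      + (fun y => a y 1) • (fun y => J 1 (F y) (V y)))
      + (fun y => a y 2) • (fun y => J 2 (F y) (V y)))
      (.of_forall fun _ => twistor_apply _ _),
    covAlong_add cov ((h 0).add (h 1)) (h 2), covAlong_add cov (h 0) (h 1),
    covAlong_smul cov (ha' 0) (hJV 0), covAlong_smul cov (ha' 1) (hJV 1),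
    covAlong_smul cov (ha' 2) (hJV 2)]
  simp only [hJ.covAlong_apply _ hV, twistor_apply, mvfderiv_apply ha]
  abel

variable
  [IsContMDiffRiemannianBundle (𝓡 (4 * n)) ∞ (EuclideanSpace ℝ (Fin (4 * n)))
    (fun p : M => TangentSpace (𝓡 (4 * n)) p)]

lemma MDiffAlong.inner (hV : MDiffAlong (𝓡 (4 * n)) I' F V x)
    (hW : MDiffAlong (𝓡 (4 * n)) I' F W x) :
    MDifferentiableAt I' 𝓘(ℝ) (fun y => (inner ℝ (V y) (W y) : ℝ)) x :=
  have : IsContMDiffRiemannianBundle (𝓡 (4 * n)) 1 (EuclideanSpace ℝ (Fin (4 * n)))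
      (fun p : M => TangentSpace (𝓡 (4 * n)) p) := .of_le (n := ∞) (by simp)
  MDifferentiableAt.inner_bundle (E := fun p : M => TangentSpace (𝓡 (4 * n)) p) hV hW

/-- Metric compatibility of the pull-back of the Levi-Civita connection. -/
theorem IsLeviCivita.mvfderiv_inner_along (hcov : IsLeviCivita cov)
    (hV : MDiffAlong (𝓡 (4 * n)) I' F V x) (hW : MDiffAlong (𝓡 (4 * n)) I' F W x)
    (v : TangentSpace I' x) :
    mvfderiv I' (fun y => (inner ℝ (V y) (W y) : ℝ)) x v
      = inner ℝ (covAlong cov F V x v) (W x) + inner ℝ (V x) (covAlong cov F W x v) := by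
  have hF := hV.mdifferentiableAt
  refine MDiffAlong.induction (V := V) (P := fun V =>
    mvfderiv I' (fun y => (inner ℝ (V y) (W y) : ℝ)) x v
      = inner ℝ (covAlong cov F V x v) (W x) + inner ℝ (V x) (covAlong cov F W x v))
    ?_ ?_ ?_ ?_ hV
  · intro V V' hV h hP
    rw [← covAlong_congr cov h, ← h.self_of_nhds, ← hP]
    exact mvfderiv_congr (h.mono fun y hy => by simp only [hy]) v
  · intro V V' hV hV' hP hP'
    simp only [Pi.add_apply, inner_add_left]
    rw [mvfderiv_fun_add (hV.inner hW) (hV'.inner hW), covAlong_add cov hV hV', inner_add_left,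
      _root_.add_apply, hP, hP']
    ring
  · intro f V hf hV hP
    simp only [Pi.smul_apply', real_inner_smul_left]
    rw [mvfderiv_fun_mul hf (hV.inner hW), covAlong_smul cov hf hV, inner_add_left,
      real_inner_smul_left, real_inner_smul_left, _root_.add_apply, _root_.smul_apply,
      _root_.smul_apply, hP, smul_eq_mul, smul_eq_mul]
    ring
  -- The first argument is now constant-coefficient; a second induction, on `W`, reduces to two
  -- fields pulled back from `M`, where metric compatibility on `M` and the chain rule conclude.
  · intro u
    have hU := mdiffAlong_extend (I' := I') hF u
    refine MDiffAlong.induction (V := W) (P := fun W =>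
      mvfderiv I' (fun y => (Inner.inner ℝ (FiberBundle.extend (EuclideanSpace ℝ (Fin (4 * n))) u
          (F y)) (W y) : ℝ)) x v
        = Inner.inner ℝ (covAlong cov F (fun y => FiberBundle.extend
            (EuclideanSpace ℝ (Fin (4 * n))) u (F y)) x v) (W x)
          + Inner.inner ℝ (FiberBundle.extend (EuclideanSpace ℝ (Fin (4 * n))) u (F x))
            (covAlong cov F W x v)) ?_ ?_ ?_ ?_ hW
    · intro V V' hV h hP
      rw [← covAlong_congr cov h, ← h.self_of_nhds, ← hP]
      exact mvfderiv_congr (h.mono fun y hy => by simp only [hy]) v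
    · intro V V' hV hV' hP hP'
      simp only [Pi.add_apply, inner_add_right]
      rw [mvfderiv_fun_add (hU.inner hV) (hU.inner hV'), covAlong_add cov hV hV', inner_add_right,
        _root_.add_apply, hP, hP']
      ring
    · intro f V hf hV hP
      simp only [Pi.smul_apply', real_inner_smul_right]
      rw [mvfderiv_fun_mul hf (hU.inner hV), covAlong_smul cov hf hV, inner_add_right,
        real_inner_smul_right, real_inner_smul_right, _root_.add_apply, _root_.smul_apply,
        _root_.smul_apply, hP, smul_eq_mul, smul_eq_mul]
      ring
    · intro w
      have hu := mdifferentiableAt_extend_tangent (I := 𝓡 (4 * n)) (F x) u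
      have hw := mdifferentiableAt_extend_tangent (I := 𝓡 (4 * n)) (F x) w
      rw [covAlong_comp cov hF hu, covAlong_comp cov hF hw, ← hcov.metric _ _ _ hu hw]
      exact congrArg (fun T => T v) (mfderiv_comp x
        (MDiffAlong.inner (F := (id : M → M)) (I' := 𝓡 (4 * n)) hu hw) hF)

end HyperkahlerAlong

/-- Both sides are the sum of all squared matrix entries `⟨T eᵢ, fⱼ⟩²`. As the right side does not
involve `e`, basis independence follows. -/
lemma sum_norm_sq_eq_sum_norm_adjoint_sq {V W ι κ : Type*} [NormedAddCommGroup V]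
    [InnerProductSpace ℝ V] [FiniteDimensional ℝ V] [NormedAddCommGroup W] [InnerProductSpace ℝ W]
    [FiniteDimensional ℝ W] [Fintype ι] [Fintype κ] (e : OrthonormalBasis ι ℝ V)
    (f : OrthonormalBasis κ ℝ W) (T : V →ₗ[ℝ] W) :
    ∑ i, ‖T (e i)‖ ^ 2 = ∑ j, ‖LinearMap.adjoint T (f j)‖ ^ 2 := by
  simp_rw [← f.sum_sq_inner_left (T _)]
  rw [Finset.sum_comm]
  refine Finset.sum_congr rfl fun j _ => ?_
  rw [← e.sum_sq_inner_right]
  refine Finset.sum_congr rfl fun i _ => ?_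
  rw [LinearMap.adjoint_inner_right]

/-- The Hilbert–Schmidt norm does not depend on the orthonormal basis. -/
lemma sum_norm_sq_eq_sum_norm_sq {V W ι κ : Type*} [NormedAddCommGroup V] [InnerProductSpace ℝ V]
    [FiniteDimensional ℝ V] [NormedAddCommGroup W] [InnerProductSpace ℝ W] [FiniteDimensional ℝ W]
    [Fintype ι] [Fintype κ] (e : OrthonormalBasis ι ℝ V) (e' : OrthonormalBasis κ ℝ V)
    (T : V →ₗ[ℝ] W) : ∑ i, ‖T (e i)‖ ^ 2 = ∑ i, ‖T (e' i)‖ ^ 2 :=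
  (sum_norm_sq_eq_sum_norm_adjoint_sq e (stdOrthonormalBasis ℝ W) T).trans
    (sum_norm_sq_eq_sum_norm_adjoint_sq e' (stdOrthonormalBasis ℝ W) T).symm

/-! ### Derivatives of sphere-valued maps. -/

section

variable {E' : Type*} [NormedAddCommGroup E'] [NormedSpace ℝ E']
  {H' : Type*} [TopologicalSpace H'] {I' : ModelWithCorners ℝ E' H'}
  {L : Type*} [TopologicalSpace L] [ChartedSpace H' L] {x : L}
  {a : L → EuclideanSpace ℝ (Fin 3)}

lemma mvfderiv_inner_const (ha : MDifferentiableAt I' 𝓘(ℝ, EuclideanSpace ℝ (Fin 3)) a x)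
    (s : EuclideanSpace ℝ (Fin 3)) (v : TangentSpace I' x) :
    mvfderiv I' (fun y => (inner ℝ s (a y) : ℝ)) x v = inner ℝ s (mvfderiv I' a x v) := by
  have h := mfderiv_comp x (innerSL ℝ s).mdifferentiableAt ha
  rw [ContinuousLinearMap.mfderiv_eq] at h
  exact congrArg (fun T => T v) h

lemma mdifferentiableAt_inner_const
    (ha : MDifferentiableAt I' 𝓘(ℝ, EuclideanSpace ℝ (Fin 3)) a x)
    (s : EuclideanSpace ℝ (Fin 3)) :
    MDifferentiableAt I' 𝓘(ℝ) (fun y => (inner ℝ s (a y) : ℝ)) x :=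
  (innerSL ℝ s).mdifferentiableAt.comp x ha

/-- Differentiate `∑ a_d² = 1`. -/
lemma inner_mvfderiv_eq_zero (ha : MDifferentiableAt I' 𝓘(ℝ, EuclideanSpace ℝ (Fin 3)) a x)
    (h1 : ∀ y, ‖a y‖ = 1) (v : TangentSpace I' x) :
    (inner ℝ (a x) (mvfderiv I' a x v) : ℝ) = 0 := by
  have hd := mdifferentiableAt_apply ha
  have hc : mvfderiv I' (fun y => a y 0 * a y 0 + a y 1 * a y 1 + a y 2 * a y 2) x v = 0 := by
    have : (fun y => a y 0 * a y 0 + a y 1 * a y 1 + a y 2 * a y 2) = fun _ => (1 : ℝ) := by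
      ext y
      rw [← inner_fin_three, real_inner_self_eq_norm_sq, h1, one_pow]
    rw [this, mvfderiv_const]
    rfl
  have hq : ∀ d, MDifferentiableAt I' 𝓘(ℝ) (fun y => a y d * a y d) x :=
    fun d => (hd d).mul (hd d)
  have hq' : MDifferentiableAt I' 𝓘(ℝ) (fun y => a y 0 * a y 0 + a y 1 * a y 1) x :=
    (hq 0).add (hq 1)
  rw [mvfderiv_fun_add hq' (hq 2), mvfderiv_fun_add (hq 0) (hq 1), mvfderiv_fun_mul (hd 0) (hd 0),
    mvfderiv_fun_mul (hd 1) (hd 1), mvfderiv_fun_mul (hd 2) (hd 2)] at hc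
  simp only [_root_.add_apply, _root_.smul_apply, smul_eq_mul, mvfderiv_apply ha] at hc
  rw [inner_fin_three]
  linarith

end

/-! ### Pointwise consequences of the hyper-Lagrangian and isometry conditions. -/

section

variable {n : ℕ} {M : Type*} [TopologicalSpace M]
  [ChartedSpace (EuclideanSpace ℝ (Fin (4 * n))) M]
  [RiemannianBundle (fun p : M => TangentSpace (𝓡 (4 * n)) p)]
  {J : Fin 3 → (p : M) → TangentSpace (𝓡 (4 * n)) p →L[ℝ] TangentSpace (𝓡 (4 * n)) p}
  {L : Type*} [TopologicalSpace L]
  [ChartedSpace (EuclideanSpace ℝ (Fin (2 * n))) L]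
  {F : L → M} {x : L} {a : L → EuclideanSpace ℝ (Fin 3)}

/-- The imaginary part of `Ω` already carries this; normalizing `k` removes the unit-length
restriction, which matters because `k` will be a derivative of the phase. -/
lemma IsComplexPhase.inner_twistor (ha : IsComplexPhase J F a)
    {k : EuclideanSpace ℝ (Fin 3)} (hk : inner ℝ (a x) k = (0 : ℝ))
    (u v : TangentSpace (𝓡 (2 * n)) x) :
    (inner ℝ (twistor J k (F x) (mfderiv (𝓡 (2 * n)) (𝓡 (4 * n)) F x u))
      (mfderiv (𝓡 (2 * n)) (𝓡 (4 * n)) F x v) : ℝ) = 0 := by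
  rcases eq_or_ne k 0 with rfl | hk0
  · rw [twistor_zero, inner_zero_left]
  have hk1 : ‖(‖k‖⁻¹ : ℝ) • k‖ = 1 := norm_smul_inv_norm (𝕜 := ℝ) hk0
  have h := congrArg Complex.im (ha.holSymplecticForm_eq_zero x ((‖k‖⁻¹ : ℝ) • k) hk1
    (by rw [inner_smul_right, hk, mul_zero]) u v)
  simp only [holSymplecticForm, Complex.sub_im, Complex.ofReal_im, Complex.mul_im, Complex.I_re,
    Complex.I_im, Complex.ofReal_re, Complex.zero_im, twistor_smul, real_inner_smul_left] at h
  have := inv_ne_zero (norm_ne_zero_iff.2 hk0)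
  simpa [this] using h

variable [RiemannianBundle (fun y : L => TangentSpace (𝓡 (2 * n)) y)]

lemma IsIsometricImmersion.norm_mfderiv
    (hF : IsIsometricImmersion (𝓡 (4 * n)) (𝓡 (2 * n)) F) (u : TangentSpace (𝓡 (2 * n)) x) :
    ‖mfderiv (𝓡 (2 * n)) (𝓡 (4 * n)) F x u‖ = ‖u‖ := by
  rw [← sq_eq_sq₀ (norm_nonneg _) (norm_nonneg _), ← real_inner_self_eq_norm_sq,
    hF.inner_mfderiv, real_inner_self_eq_norm_sq]

end

/-! ### The covariant derivative of `J_Ψ` and its norm. -/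

section

variable {n : ℕ} {M : Type*} [TopologicalSpace M]
  [ChartedSpace (EuclideanSpace ℝ (Fin (4 * n))) M] [IsManifold (𝓡 (4 * n)) ∞ M]
  [RiemannianBundle (fun p : M => TangentSpace (𝓡 (4 * n)) p)]
  {cov : CovariantDerivative (𝓡 (4 * n)) (EuclideanSpace ℝ (Fin (4 * n)))
    (TangentSpace (𝓡 (4 * n)) : M → Type _)}
  {J : Fin 3 → (p : M) → TangentSpace (𝓡 (4 * n)) p →L[ℝ] TangentSpace (𝓡 (4 * n)) p}
  {L : Type*} [TopologicalSpace L]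
  [ChartedSpace (EuclideanSpace ℝ (Fin (2 * n))) L]
  {F : L → M} {x : L} {a : L → EuclideanSpace ℝ (Fin 3)}

lemma IsHyperkahler.norm_twistor (hJ : IsHyperkahler cov J) (c : EuclideanSpace ℝ (Fin 3)) {p : M}
    (u : TangentSpace (𝓡 (4 * n)) p) : ‖twistor J c p u‖ = ‖c‖ * ‖u‖ := by
  rw [← sq_eq_sq₀ (norm_nonneg _) (by positivity), mul_pow, ← real_inner_self_eq_norm_sq,
    hJ.inner_twistor_twistor, real_inner_self_eq_norm_sq, real_inner_self_eq_norm_sq]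

lemma IsHyperkahler.twistor_anticomm (hJ : IsHyperkahler cov J) {c d : EuclideanSpace ℝ (Fin 3)}
    (h : inner ℝ c d = (0 : ℝ)) {p : M} (u : TangentSpace (𝓡 (4 * n)) p) :
    twistor J c p (twistor J d p u) = -twistor J d p (twistor J c p u) := by
  have hc : cross c d = (-1 : ℝ) • cross d c := by
    ext i
    fin_cases i <;> simp [cross] <;> ring
  rw [hJ.twistor_twistor, hJ.twistor_twistor, hc, twistor_smul, real_inner_comm c d, h]
  simp

/-- The `J_d` being parallel, only the coefficients of the twistor element get differentiated. -/
lemma IsHyperkahler.covEndAlong_twistor (hJ : IsHyperkahler cov J)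
    (hF : MDifferentiableAt (𝓡 (2 * n)) (𝓡 (4 * n)) F x)
    (ha : MDifferentiableAt (𝓡 (2 * n)) 𝓘(ℝ, EuclideanSpace ℝ (Fin 3)) a x)
    (v : TangentSpace (𝓡 (2 * n)) x) (w : TangentSpace (𝓡 (4 * n)) (F x)) :
    covEndAlong cov F (fun y => twistor J (a y) (F y)) x v w
      = twistor J (mvfderiv (𝓡 (2 * n)) a x v) (F x) w := by
  rw [covEndAlong, hJ.covAlong_twistor ha (mdiffAlong_extend hF w), FiberBundle.extend_apply_self]
  exact add_sub_cancel_right _ _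

variable [RiemannianBundle (fun y : L => TangentSpace (𝓡 (2 * n)) y)]

lemma finrank_tangentSpace_euclidean {m : ℕ} {N : Type*} [TopologicalSpace N]
    [ChartedSpace (EuclideanSpace ℝ (Fin m)) N] (p : N) :
    Module.finrank ℝ (TangentSpace (𝓡 m) p) = m :=
  finrank_euclideanSpace_fin (𝕜 := ℝ)

/-- `|∇̄J_Ψ|² = 4n |∇a|²`, in terms of an arbitrary orthonormal basis of the tangent space. -/
theorem IsHyperkahler.normSqCovEndAlong_twistor {ι : Type*} [Fintype ι] (hJ : IsHyperkahler cov J)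
    (hF : MDifferentiableAt (𝓡 (2 * n)) (𝓡 (4 * n)) F x)
    (ha : MDifferentiableAt (𝓡 (2 * n)) 𝓘(ℝ, EuclideanSpace ℝ (Fin 3)) a x)
    (e : OrthonormalBasis ι ℝ (TangentSpace (𝓡 (2 * n)) x)) :
    normSqCovEndAlong (I' := 𝓡 (2 * n)) cov F (fun y => twistor J (a y) (F y)) x
      = 4 * n * ∑ i, ‖mvfderiv (𝓡 (2 * n)) a x (e i)‖ ^ 2 := by
  have h := sum_norm_sq_eq_sum_norm_sq e (stdOrthonormalBasis ℝ (TangentSpace (𝓡 (2 * n)) x))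
    (mvfderiv (𝓡 (2 * n)) a x : TangentSpace (𝓡 (2 * n)) x →ₗ[ℝ] EuclideanSpace ℝ (Fin 3))
  simp only [ContinuousLinearMap.coe_coe] at h
  rw [h, Finset.mul_sum, normSqCovEndAlong]
  refine Finset.sum_congr rfl fun i _ => ?_
  -- Summing over `B` gives `|J_s e_A|² = |s|²`, and `A` takes `4n` values.
  simp only [hJ.covEndAlong_twistor hF ha, OrthonormalBasis.sum_sq_inner_left,
    hJ.norm_twistor, OrthonormalBasis.norm_eq_one, mul_one, Finset.sum_const, Finset.card_univ,
    Fintype.card_fin, finrank_tangentSpace_euclidean, nsmul_eq_mul]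
  push_cast
  ring

lemma normSqGradient_eq (ha : MDifferentiableAt (𝓡 (2 * n)) 𝓘(ℝ, EuclideanSpace ℝ (Fin 3)) a x) :
    normSqGradient (𝓡 (2 * n)) a x
      = ∑ i, ‖mvfderiv (𝓡 (2 * n)) a x
          (stdOrthonormalBasis ℝ (TangentSpace (𝓡 (2 * n)) x) i)‖ ^ 2 := by
  rw [normSqGradient, Finset.sum_comm]
  simp only [mvfderiv_apply ha, EuclideanSpace.norm_sq_eq, Real.norm_eq_abs, sq_abs]

/-! ### The tangent space of a hyper-Lagrangian submanifold -/

/-- The field `dF(Z)` is the section `Z` followed by the tangent map of `F`. -/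
lemma IsIsometricImmersion.mdiffAlong [IsManifold (𝓡 (2 * n)) ∞ L]
    (hF : IsIsometricImmersion (𝓡 (4 * n)) (𝓡 (2 * n)) F)
    {Z : (y : L) → TangentSpace (𝓡 (2 * n)) y}
    (hZ : MDifferentiableAt (𝓡 (2 * n)) (𝓡 (2 * n)).tangent
      (fun y => (⟨y, Z y⟩ : TangentBundle (𝓡 (2 * n)) L)) x) :
    MDiffAlong (𝓡 (4 * n)) (𝓡 (2 * n)) F
      (fun y => mfderiv (𝓡 (2 * n)) (𝓡 (4 * n)) F y (Z y)) x :=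
  have h := (hF.contMDiff.contMDiff_tangentMap (m := ∞) (by simp)).mdifferentiable (by simp)
  MDifferentiableAt.comp (g := tangentMap (𝓡 (2 * n)) (𝓡 (4 * n)) F)
    (f := fun y => (⟨y, Z y⟩ : TangentBundle (𝓡 (2 * n)) L)) x (h ⟨x, Z x⟩) hZ

/-- `J_Ψ` preserves the tangent space of a hyper-Lagrangian submanifold. -/
theorem IsComplexPhase.twistor_mem_range [IsManifold (𝓡 (2 * n)) ∞ L] (hJ : IsHyperkahler cov J)
    (hF : IsIsometricImmersion (𝓡 (4 * n)) (𝓡 (2 * n)) F) (ha : IsComplexPhase J F a)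
    {s : EuclideanSpace ℝ (Fin 3)} (hs0 : s ≠ 0) (hs : inner ℝ (a x) s = (0 : ℝ))
    (u : TangentSpace (𝓡 (2 * n)) x) :
    twistor J (a x) (F x) (mfderiv (𝓡 (2 * n)) (𝓡 (4 * n)) F x u)
      ∈ (mfderiv (𝓡 (2 * n)) (𝓡 (4 * n)) F x).range := by
  set D := mfderiv (𝓡 (2 * n)) (𝓡 (4 * n)) F x with hD
  let T : Submodule ℝ (TangentSpace (𝓡 (4 * n)) (F x)) := D.range
  let Js : TangentSpace (𝓡 (4 * n)) (F x) →ₗ[ℝ] TangentSpace (𝓡 (4 * n)) (F x) :=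
    (twistor J s (F x) : TangentSpace (𝓡 (4 * n)) (F x) →ₗ[ℝ] TangentSpace (𝓡 (4 * n)) (F x))
  have hDinj : Function.Injective (D : TangentSpace (𝓡 (2 * n)) x →ₗ[ℝ]
      TangentSpace (𝓡 (4 * n)) (F x)) := by
    refine (injective_iff_map_eq_zero _).2 fun w hw => norm_eq_zero.1 ?_
    rw [← hF.norm_mfderiv, ← hD]
    exact (congrArg norm hw).trans norm_zero
  have hJsinj : Function.Injective Js := by
    refine (injective_iff_map_eq_zero _).2 fun w hw => norm_eq_zero.1 ?_
    have h : ‖twistor J s (F x) w‖ = 0 := (congrArg norm hw).trans norm_zero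
    rw [hJ.norm_twistor] at h
    exact (mul_eq_zero.1 h).resolve_left (norm_ne_zero_iff.2 hs0)
  have hT : Module.finrank ℝ T = 2 * n :=
    (LinearMap.finrank_range_of_inj hDinj).trans (finrank_tangentSpace_euclidean x)
  -- `J_s T` is normal and has dimension `2n`, half of the ambient dimension, so it is the whole
  -- normal space.
  have hle : T.map Js ≤ Tᗮ := by
    rintro _ ⟨_, ⟨w, rfl⟩, rfl⟩
    rw [Submodule.mem_orthogonal']
    rintro _ ⟨z, rfl⟩
    exact ha.inner_twistor hs w z
  have hrank : Module.finrank ℝ (T.map Js) = 2 * n :=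
    (LinearEquiv.finrank_eq (Submodule.equivMapOfInjective Js hJsinj T)).symm.trans hT
  have hrank' : Module.finrank ℝ T + Module.finrank ℝ Tᗮ = 4 * n :=
    T.finrank_add_finrank_orthogonal.trans (finrank_tangentSpace_euclidean (F x))
  have heq : T.map Js = Tᗮ := Submodule.eq_of_le_of_finrank_eq hle (by omega)
  change _ ∈ T
  -- It remains to see that `J_Ψ u` is orthogonal to `J_s T`: moving `J_s` across produces `J_{s ×
  -- a}`, and `s × a ⊥ a`.
  rw [← T.orthogonal_orthogonal, ← heq, Submodule.mem_orthogonal]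
  rintro _ ⟨_, ⟨w, rfl⟩, rfl⟩
  change (inner ℝ (twistor J s (F x) (D w)) (twistor J (a x) (F x) (D u)) : ℝ) = 0
  rw [hJ.inner_twistor_left, hJ.twistor_twistor, real_inner_comm (a x) s, hs, neg_zero, zero_smul,
    zero_add, real_inner_comm _ (D w), ha.inner_twistor (inner_cross_self_right _ _), neg_zero]

end

section

variable {n : ℕ} {M : Type*} [TopologicalSpace M]
  [ChartedSpace (EuclideanSpace ℝ (Fin (4 * n))) M]
  [RiemannianBundle (fun p : M => TangentSpace (𝓡 (4 * n)) p)]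
  {J : Fin 3 → (p : M) → TangentSpace (𝓡 (4 * n)) p →L[ℝ] TangentSpace (𝓡 (4 * n)) p}
  {L : Type*} [TopologicalSpace L] [ChartedSpace (EuclideanSpace ℝ (Fin (2 * n))) L]
  {F : L → M} {a b : L → EuclideanSpace ℝ (Fin 3)}
  {e : Fin n × Fin 2 → (y : L) → TangentSpace (𝓡 (2 * n)) y} {U : Set L} {x : L}

lemma IsComplexPhase.mdifferentiableAt (ha : IsComplexPhase J F a) :
    MDifferentiableAt (𝓡 (2 * n)) 𝓘(ℝ, EuclideanSpace ℝ (Fin 3)) a x :=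
  ha.contMDiff.mdifferentiable (by simp) x

variable [IsManifold (𝓡 (2 * n)) ∞ L] [RiemannianBundle (fun y : L => TangentSpace (𝓡 (2 * n)) y)]

lemma IsAdaptedFrame.inner_mfderiv_frame
    (hF : IsIsometricImmersion (𝓡 (4 * n)) (𝓡 (2 * n)) F)
    (he : IsAdaptedFrame J F a b e U) (hx : x ∈ U) (i j : Fin n × Fin 2) :
    (inner ℝ (mfderiv (𝓡 (2 * n)) (𝓡 (4 * n)) F x (e i x))
      (mfderiv (𝓡 (2 * n)) (𝓡 (4 * n)) F x (e j x)) : ℝ) = if i = j then 1 else 0 := by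
  rw [hF.inner_mfderiv]
  exact orthonormal_iff_ite.1 (he.orthonormal x hx) i j

end

variable {n : ℕ} {M : Type*} [TopologicalSpace M]
  [ChartedSpace (EuclideanSpace ℝ (Fin (4 * n))) M] [IsManifold (𝓡 (4 * n)) ∞ M]
  [RiemannianBundle (fun p : M => TangentSpace (𝓡 (4 * n)) p)]
  {cov : CovariantDerivative (𝓡 (4 * n)) (EuclideanSpace ℝ (Fin (4 * n)))
    (TangentSpace (𝓡 (4 * n)) : M → Type _)}
  {J : Fin 3 → (p : M) → TangentSpace (𝓡 (4 * n)) p →L[ℝ] TangentSpace (𝓡 (4 * n)) p}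
  {L : Type*} [TopologicalSpace L]
  [ChartedSpace (EuclideanSpace ℝ (Fin (2 * n))) L] [IsManifold (𝓡 (2 * n)) ∞ L]
  [RiemannianBundle (fun y : L => TangentSpace (𝓡 (2 * n)) y)]
  {F : L → M} {a b : L → EuclideanSpace ℝ (Fin 3)}
  {e : Fin n × Fin 2 → (y : L) → TangentSpace (𝓡 (2 * n)) y} {U : Set L} {x : L}

/-! ### The formula in a canonical frame. -/

section CanonicalFrame

/-- The coefficients `h^{2μ}_{k,i}` of the canonical frame in terms of `e_{2μ-1}`: since
`e_{2μ} = -J_Ψ e_{2μ-1}` for the normal part of the frame,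
`∇̄_v e_{2μ} = -(∇̄_v J_Ψ) e_{2μ-1} - J_Ψ ∇̄_v e_{2μ-1}`. -/
lemma IsAdaptedFrame.covAlong_normalFrame_one (hJ : IsHyperkahler cov J)
    (hF : IsIsometricImmersion (𝓡 (4 * n)) (𝓡 (2 * n)) F) (ha : IsComplexPhase J F a)
    (he : IsAdaptedFrame J F a b e U) (hx : x ∈ U) (μ : Fin n) (v : TangentSpace (𝓡 (2 * n)) x) :
    covAlong cov F (normalFrame J F b e (μ, 1)) x v
      = -(twistor J (mvfderiv (𝓡 (2 * n)) a x v) (F x) (normalFrame J F b e (μ, 0) x)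
        + twistor J (a x) (F x) (covAlong cov F (normalFrame J F b e (μ, 0)) x v)) := by
  have hU : U ∈ 𝓝 x := he.isOpen.mem_nhds hx
  have hb : MDifferentiableAt (𝓡 (2 * n)) 𝓘(ℝ, EuclideanSpace ℝ (Fin 3)) b x :=
    (he.contMDiffOn_phase.contMDiffAt hU).mdifferentiableAt (by simp)
  have hE : MDiffAlong (𝓡 (4 * n)) (𝓡 (2 * n)) F
      (fun y => mfderiv (𝓡 (2 * n)) (𝓡 (4 * n)) F y (e (μ, 0) y)) x :=
    hF.mdiffAlong (((he.contMDiffOn_frame (μ, 0)).contMDiffAt hU).mdifferentiableAt (by simp))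
  have hN : MDiffAlong (𝓡 (4 * n)) (𝓡 (2 * n)) F (normalFrame J F b e (μ, 0)) x :=
    hJ.mdiffAlong_twistor hb hE
  have hJN := hJ.mdiffAlong_twistor (ha.mdifferentiableAt (x := x)) hN
  rw [← hJ.covAlong_twistor ha.mdifferentiableAt hN]
  have h1 := covAlong_smul cov (f := fun _ : L => (-1 : ℝ)) mdifferentiableAt_const hJN v
  rw [mvfderiv_const, _root_.zero_apply, zero_smul, zero_add, neg_one_smul] at h1
  rw [← h1]
  refine covAlong_congr cov ?_ v
  filter_upwards [hU] with y hy
  simp only [normalFrame, Pi.smul_apply', neg_one_smul]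
  rw [← he.twistor_frame y hy μ, hJ.twistor_anticomm]
  rw [real_inner_comm, he.phase_orthogonal y hy]

theorem IsAdaptedFrame.sum_coeffSecondFundamentalForm (hJ : IsHyperkahler cov J)
    (hF : IsIsometricImmersion (𝓡 (4 * n)) (𝓡 (2 * n)) F) (ha : IsComplexPhase J F a)
    (he : IsAdaptedFrame J F a b e U) (hx : x ∈ U) (i : Fin n × Fin 2) :
    ∑ ν : Fin n, ∑ μ : Fin n,
      ((coeffSecondFundamentalForm cov J F b e x (μ, 0) (ν, 1) i
          - coeffSecondFundamentalForm cov J F b e x (μ, 1) (ν, 0) i) ^ 2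
        + (coeffSecondFundamentalForm cov J F b e x (μ, 0) (ν, 0) i
          + coeffSecondFundamentalForm cov J F b e x (μ, 1) (ν, 1) i) ^ 2)
      = n * ‖mvfderiv (𝓡 (2 * n)) a x (e i x)‖ ^ 2 := by
  set s := mvfderiv (𝓡 (2 * n)) a x (e i x) with hs
  have haa : (inner ℝ (a x) (a x) : ℝ) = 1 := by
    rw [real_inner_self_eq_norm_sq, ha.norm_eq_one, one_pow]
  have hbb : (inner ℝ (b x) (b x) : ℝ) = 1 := by
    rw [real_inner_self_eq_norm_sq, he.norm_phase x hx, one_pow]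
  have hcross : cross s (b x) = (inner ℝ (a x) (cross s (b x)) : ℝ) • a x :=
    cross_eq_smul haa (he.phase_orthogonal x hx)
      (inner_mvfderiv_eq_zero ha.mdifferentiableAt ha.norm_eq_one _)
  set ρ : ℝ := inner ℝ (a x) (cross s (b x))
  -- `⟨s, b⟩` and `ρ` are, up to sign, the components of `s` in the orthonormal basis `b`, `a × b`
  -- of the plane `a^⊥`.
  have hρ : (inner ℝ s (b x) : ℝ) ^ 2 + ρ ^ 2 = ‖s‖ ^ 2 := by
    have h := inner_cross_cross s (b x)
    rw [hcross, real_inner_smul_left, real_inner_smul_right, haa, hbb,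
      real_inner_self_eq_norm_sq] at h
    linarith
  have hsN : ∀ μ, twistor J s (F x) (normalFrame J F b e (μ, 0) x)
      = -(inner ℝ s (b x) : ℝ) • mfderiv (𝓡 (2 * n)) (𝓡 (4 * n)) F x (e (μ, 0) x)
        + ρ • mfderiv (𝓡 (2 * n)) (𝓡 (4 * n)) F x (e (μ, 1) x) := by
    intro μ
    rw [normalFrame, hJ.twistor_twistor, hcross, twistor_smul, he.twistor_frame x hx]
  have hin := he.inner_mfderiv_frame hF hx
  have hJe : ∀ ν, twistor J (a x) (F x) (mfderiv (𝓡 (2 * n)) (𝓡 (4 * n)) F x (e (ν, 1) x))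
      = -mfderiv (𝓡 (2 * n)) (𝓡 (4 * n)) F x (e (ν, 0) x) := by
    intro ν
    rw [← he.twistor_frame x hx ν, hJ.twistor_twistor, haa, cross_self, twistor_zero, add_zero,
      neg_one_smul]
  -- Skew-symmetry of `J_Ψ` turns its term into `h^{2μ-1}_{2ν,i}`, which cancels; only the `J_s`
  -- term is left.
  have h1 : ∀ ν μ, coeffSecondFundamentalForm cov J F b e x (μ, 0) (ν, 1) i
      - coeffSecondFundamentalForm cov J F b e x (μ, 1) (ν, 0) i
      = if ν = μ then -(inner ℝ s (b x) : ℝ) else 0 := by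
    intro ν μ
    have hskew := hJ.inner_twistor_left (a x)
      (mfderiv (𝓡 (2 * n)) (𝓡 (4 * n)) F x (e (ν, 0) x))
      (covAlong cov F (normalFrame J F b e (μ, 0)) x (e i x))
    rw [he.twistor_frame x hx] at hskew
    simp only [coeffSecondFundamentalForm]
    rw [he.covAlong_normalFrame_one hJ hF ha hx, ← hs, inner_neg_right, inner_add_right, hskew, hsN,
      inner_add_right, inner_smul_right, inner_smul_right, hin, hin]
    simp
  have h2 : ∀ ν μ, coeffSecondFundamentalForm cov J F b e x (μ, 0) (ν, 0) i
      + coeffSecondFundamentalForm cov J F b e x (μ, 1) (ν, 1) i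
      = if ν = μ then -ρ else 0 := by
    intro ν μ
    have hskew := hJ.inner_twistor_left (a x)
      (mfderiv (𝓡 (2 * n)) (𝓡 (4 * n)) F x (e (ν, 1) x))
      (covAlong cov F (normalFrame J F b e (μ, 0)) x (e i x))
    rw [hJe, inner_neg_left, neg_inj] at hskew
    simp only [coeffSecondFundamentalForm]
    rw [he.covAlong_normalFrame_one hJ hF ha hx, ← hs, inner_neg_right, inner_add_right,
      ← hskew, hsN,
      inner_add_right, inner_smul_right, inner_smul_right, hin, hin]
    simp
    split_ifs <;> ring
  simp only [h1, h2]
  have h3 : ∀ ν μ : Fin n, (if ν = μ then -(inner ℝ s (b x) : ℝ) else 0) ^ 2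
      + (if ν = μ then -ρ else 0) ^ 2 = if ν = μ then ‖s‖ ^ 2 else 0 := by
    intro ν μ
    split_ifs
    · linarith
    · simp
  simp only [h3]
  simp

theorem IsAdaptedFrame.normSqCovEndAlong_twistor (hJ : IsHyperkahler cov J)
    (hF : IsIsometricImmersion (𝓡 (4 * n)) (𝓡 (2 * n)) F) (ha : IsComplexPhase J F a)
    (he : IsAdaptedFrame J F a b e U) (hx : x ∈ U) :
    normSqCovEndAlong (I' := 𝓡 (2 * n)) cov F (fun y => twistor J (a y) (F y)) x
      = 4 * ∑ i : Fin n × Fin 2, ∑ ν : Fin n, ∑ μ : Fin n,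
        ((coeffSecondFundamentalForm cov J F b e x (μ, 0) (ν, 1) i
            - coeffSecondFundamentalForm cov J F b e x (μ, 1) (ν, 0) i) ^ 2
          + (coeffSecondFundamentalForm cov J F b e x (μ, 0) (ν, 0) i
            + coeffSecondFundamentalForm cov J F b e x (μ, 1) (ν, 1) i) ^ 2) := by
  have hon := he.orthonormal x hx
  -- The `2n` orthonormal frame vectors form a basis, so the frame can replace the standard basis in
  -- the norm.
  have hspan : ⊤ ≤ Submodule.span ℝ (Set.range fun i => e i x) :=
    (hon.linearIndependent.span_eq_top_of_card_eq_finrank' (by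
      rw [finrank_tangentSpace_euclidean]
      simp [mul_comm])).ge
  have h := hJ.normSqCovEndAlong_twistor (hF.contMDiff.mdifferentiable (by simp) x)
    ha.mdifferentiableAt (OrthonormalBasis.mk hon hspan)
  simp only [OrthonormalBasis.coe_mk] at h
  rw [h]
  simp only [he.sum_coeffSecondFundamentalForm hJ hF ha hx]
  rw [← Finset.mul_sum, mul_assoc]

end CanonicalFrame

/-! ### Bounding the derivative of the phase by the second fundamental form. -/

section Estimate

variable [IsContMDiffRiemannianBundle (𝓡 (4 * n)) ∞ (EuclideanSpace ℝ (Fin (4 * n)))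
    (fun p : M => TangentSpace (𝓡 (4 * n)) p)]

/-- Differentiating `Ω_Ψ(W, Z) = 0` expresses the derivative of the phase by the second fundamental
form. -/
theorem IsComplexPhase.norm_sq_mul_inner_twistor (hJ : IsHyperkahler cov J)
    (hF : IsIsometricImmersion (𝓡 (4 * n)) (𝓡 (2 * n)) F) (ha : IsComplexPhase J F a)
    (v w z : TangentSpace (𝓡 (2 * n)) x) {s : EuclideanSpace ℝ (Fin 3)}
    (hs : s = mvfderiv (𝓡 (2 * n)) a x v) :
    ‖s‖ ^ 2 * (inner ℝ (twistor J (a x) (F x) (mfderiv (𝓡 (2 * n)) (𝓡 (4 * n)) F x w))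
        (mfderiv (𝓡 (2 * n)) (𝓡 (4 * n)) F x z) : ℝ)
      = inner ℝ (twistor J s (F x) (mfderiv (𝓡 (2 * n)) (𝓡 (4 * n)) F x w))
          (secondFundamentalForm cov F x v z)
        - inner ℝ (secondFundamentalForm cov F x v w)
          (twistor J s (F x) (mfderiv (𝓡 (2 * n)) (𝓡 (4 * n)) F x z)) := by
  have had := ha.mdifferentiableAt (x := x)
  have hsa : (inner ℝ (a x) s : ℝ) = 0 := by
    rw [hs]
    exact inner_mvfderiv_eq_zero had ha.norm_eq_one v
  -- Projecting the fixed vector `s` to `a^⊥` gives a field with value `s` at `x` whose derivative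
  -- along `v` is `-|s|² a`, the source of the factor `|s|²`.
  let b : L → EuclideanSpace ℝ (Fin 3) := fun y => s - (inner ℝ s (a y) : ℝ) • a y
  have hsad := mdifferentiableAt_inner_const had s
  have hc : MDifferentiableAt (𝓡 (2 * n)) 𝓘(ℝ, EuclideanSpace ℝ (Fin 3)) (fun _ : L => s) x :=
    mdifferentiableAt_const
  have hbd : MDifferentiableAt (𝓡 (2 * n)) 𝓘(ℝ, EuclideanSpace ℝ (Fin 3)) b x :=
    hc.sub (hsad.smul had)
  have hbx : b x = s := by
    simp only [b]
    rw [real_inner_comm, hsa, zero_smul, sub_zero]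
  have hdb : mvfderiv (𝓡 (2 * n)) b x v = (-‖s‖ ^ 2) • a x := by
    have h1 : mvfderiv (𝓡 (2 * n)) b x = mvfderiv (𝓡 (2 * n)) (fun _ : L => s) x
        - mvfderiv (𝓡 (2 * n)) (fun y => (inner ℝ s (a y) : ℝ) • a y) x :=
      mvfderiv_fun_sub hc (hsad.smul had)
    rw [h1, mvfderiv_fun_smul hsad had, mvfderiv_const, _root_.sub_apply, _root_.zero_apply,
      _root_.add_apply, _root_.smul_apply, ContinuousLinearMap.smulRight_apply,
      mvfderiv_inner_const had, ← hs, real_inner_comm, hsa, real_inner_self_eq_norm_sq]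
    simp
  let W : TangentSpace (𝓡 (2 * n)) x → (y : L) → TangentSpace (𝓡 (4 * n)) (F y) := fun w y =>
    mfderiv (𝓡 (2 * n)) (𝓡 (4 * n)) F y (FiberBundle.extend (EuclideanSpace ℝ (Fin (2 * n))) w y)
  have hW : ∀ w, MDiffAlong (𝓡 (4 * n)) (𝓡 (2 * n)) F (W w) x := fun w =>
    hF.mdiffAlong (mdifferentiableAt_extend_tangent x w)
  have hWx : ∀ w, W w x = mfderiv (𝓡 (2 * n)) (𝓡 (4 * n)) F x w := fun w => by
    simp only [W, FiberBundle.extend_apply_self]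
  have hzero : (fun y => (inner ℝ (twistor J (b y) (F y) (W w y)) (W z y) : ℝ)) = fun _ => 0 := by
    ext y
    refine ha.inner_twistor ?_ _ _
    simp only [b]
    rw [inner_sub_right, inner_smul_right, real_inner_self_eq_norm_sq, ha.norm_eq_one,
      real_inner_comm]
    ring
  have hder := hJ.isLeviCivita.mvfderiv_inner_along (hJ.mdiffAlong_twistor hbd (hW w)) (hW z) v
  rw [hzero, mvfderiv_const, _root_.zero_apply, hJ.covAlong_twistor hbd (hW w), hdb, hbx, hWx, hWx,
    inner_add_left, twistor_smul, real_inner_smul_left, hJ.inner_twistor_left s] at hder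
  let T : Submodule ℝ (TangentSpace (𝓡 (4 * n)) (F x)) :=
    (mfderiv (𝓡 (2 * n)) (𝓡 (4 * n)) F x).range
  -- Pairing with normal vectors of this form sees only the normal part of `∇̄`, so `∇̄` may be
  -- replaced by `A`.
  have hmem : ∀ w, twistor J s (F x) (mfderiv (𝓡 (2 * n)) (𝓡 (4 * n)) F x w) ∈ Tᗮ := by
    intro w
    rw [Submodule.mem_orthogonal']
    rintro _ ⟨z, rfl⟩
    exact ha.inner_twistor hsa w z
  have hA : ∀ w z, (inner ℝ (secondFundamentalForm cov F x v w)
        (twistor J s (F x) (mfderiv (𝓡 (2 * n)) (𝓡 (4 * n)) F x z)) : ℝ)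
      = inner ℝ (covAlong cov F (W w) x v)
        (twistor J s (F x) (mfderiv (𝓡 (2 * n)) (𝓡 (4 * n)) F x z)) := by
    intro w z
    change (inner ℝ (Tᗮ.starProjection (covAlong cov F (W w) x v)) _ : ℝ) = _
    rw [Submodule.inner_starProjection_left_eq_right,
      Submodule.starProjection_eq_self_iff.2 (hmem z)]
  have hzw := hA z w
  rw [real_inner_comm, real_inner_comm _ (covAlong cov F (W z) x v)] at hzw
  rw [hA, hzw]
  linarith

/-- The derivative of the complex phase in a given direction is bounded by the second fundamental
form. -/
theorem IsComplexPhase.norm_sq_mvfderiv_le (hJ : IsHyperkahler cov J)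
    (hF : IsIsometricImmersion (𝓡 (4 * n)) (𝓡 (2 * n)) F) (ha : IsComplexPhase J F a)
    {ι : Type*} [Fintype ι] (ε : OrthonormalBasis ι ℝ (TangentSpace (𝓡 (2 * n)) x))
    (v : TangentSpace (𝓡 (2 * n)) x) :
    ‖mvfderiv (𝓡 (2 * n)) a x v‖ ^ 2 ≤ 4 * ∑ j, ‖secondFundamentalForm cov F x v (ε j)‖ ^ 2 := by
  obtain ⟨s, hs⟩ : ∃ s, s = mvfderiv (𝓡 (2 * n)) a x v := ⟨_, rfl⟩
  rw [← hs]
  rcases eq_or_ne s 0 with h0 | h0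
  · rw [h0, norm_zero, zero_pow two_ne_zero]
    positivity
  have hsa : (inner ℝ (a x) s : ℝ) = 0 := by
    rw [hs]
    exact inner_mvfderiv_eq_zero ha.mdifferentiableAt ha.norm_eq_one v
  have hs0 : 0 < ‖s‖ := norm_pos_iff.2 h0
  -- The final summation carries a factor `card ι` on both sides, which must be cancelled.
  have hι : 0 < (Fintype.card ι : ℝ) := by
    have hv : v ≠ 0 := by
      rintro rfl
      exact h0 (hs.trans (map_zero _))
    have : Nonempty ι := by
      by_contra hne
      rw [not_nonempty_iff] at hne
      apply hv
      rw [← ε.sum_repr v, Finset.univ_eq_empty, Finset.sum_empty]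
    exact_mod_cast Fintype.card_pos
  let q : ι → ι → ℝ := fun j k =>
    inner ℝ (twistor J (a x) (F x) (mfderiv (𝓡 (2 * n)) (𝓡 (4 * n)) F x (ε j)))
      (mfderiv (𝓡 (2 * n)) (𝓡 (4 * n)) F x (ε k))
  let A : ι → ℝ := fun j => ‖secondFundamentalForm cov F x v (ε j)‖
  -- `J_Ψ εⱼ` is a unit tangent vector, so its coefficients in the tangent basis have total square
  -- `1`.
  have hq : ∀ j, ∑ k, q j k ^ 2 = 1 := by
    intro j
    obtain ⟨w, hw⟩ := ha.twistor_mem_range hJ hF h0 hsa (ε j)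
    have hw' : twistor J (a x) (F x) (mfderiv (𝓡 (2 * n)) (𝓡 (4 * n)) F x (ε j))
        = mfderiv (𝓡 (2 * n)) (𝓡 (4 * n)) F x w := hw.symm
    have hnorm : ‖w‖ = 1 := by
      rw [← hF.norm_mfderiv, ← hw', hJ.norm_twistor, hF.norm_mfderiv, ha.norm_eq_one,
        ε.norm_eq_one, one_mul]
    simp only [q, hw', hF.inner_mfderiv]
    rw [ε.sum_sq_inner_left, hnorm, one_pow]
  have hbound : ∀ j k, ‖s‖ ^ 2 * q j k ^ 2 ≤ 2 * (A j ^ 2 + A k ^ 2) := by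
    intro j k
    have hn : ∀ i, ‖twistor J s (F x) (mfderiv (𝓡 (2 * n)) (𝓡 (4 * n)) F x (ε i))‖ = ‖s‖ := by
      intro i
      rw [hJ.norm_twistor, hF.norm_mfderiv, ε.norm_eq_one, mul_one]
    have h := ha.norm_sq_mul_inner_twistor hJ hF v (ε j) (ε k) hs
    have h1 := abs_real_inner_le_norm
      (twistor J s (F x) (mfderiv (𝓡 (2 * n)) (𝓡 (4 * n)) F x (ε j)))
      (secondFundamentalForm cov F x v (ε k))
    have h2 := abs_real_inner_le_norm (secondFundamentalForm cov F x v (ε j))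
      (twistor J s (F x) (mfderiv (𝓡 (2 * n)) (𝓡 (4 * n)) F x (ε k)))
    rw [hn] at h1 h2
    -- The vectors `J_s εᵢ` have length `|s|`, so one factor `|s|` cancels.
    have h3 : ‖s‖ * (‖s‖ * |q j k|) ≤ ‖s‖ * (A j + A k) := by
      calc ‖s‖ * (‖s‖ * |q j k|) = |‖s‖ ^ 2 * q j k| := by
            rw [abs_mul, abs_of_nonneg (sq_nonneg ‖s‖)]
            ring
        _ ≤ _ := by
            rw [h]
            refine (abs_sub _ _).trans ?_
            simp only [A]
            linarith
    have h4 : ‖s‖ * |q j k| ≤ A j + A k := le_of_mul_le_mul_left h3 hs0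
    calc ‖s‖ ^ 2 * q j k ^ 2 = (‖s‖ * |q j k|) ^ 2 := by rw [mul_pow, sq_abs]
      _ ≤ (A j + A k) ^ 2 := pow_le_pow_left₀ (by positivity) h4 2
      _ ≤ 2 * (A j ^ 2 + A k ^ 2) := add_sq_le
  -- With `m = card ι`, the left side is `m |s|²` and the right side is `4m ∑ⱼ Aⱼ²`.
  have hsum : ∑ j, ∑ k, ‖s‖ ^ 2 * q j k ^ 2 ≤ ∑ j, ∑ k, 2 * (A j ^ 2 + A k ^ 2) :=
    Finset.sum_le_sum fun j _ => Finset.sum_le_sum fun k _ => hbound j k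
  simp only [← Finset.mul_sum, hq, Finset.sum_add_distrib, Finset.sum_const, Finset.card_univ,
    nsmul_eq_mul, mul_one] at hsum
  refine le_of_mul_le_mul_left ?_ hι
  simp only [A] at hsum
  linarith

theorem IsComplexPhase.normSqGradient_le (hJ : IsHyperkahler cov J)
    (hF : IsIsometricImmersion (𝓡 (4 * n)) (𝓡 (2 * n)) F) (ha : IsComplexPhase J F a) (x : L) :
    normSqGradient (𝓡 (2 * n)) a x
      ≤ 4 * normSqSecondFundamentalForm (I' := 𝓡 (2 * n)) cov F x := by
  rw [normSqGradient_eq ha.mdifferentiableAt, normSqSecondFundamentalForm, Finset.mul_sum]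
  exact Finset.sum_le_sum fun i _ => ha.norm_sq_mvfderiv_le hJ hF _ _

end Estimate

end HyperLagrangian

end

theorem proposition2p4 (n : ℕ) : ∃ c : ℝ,
    ∀ (M : Type u) [TopologicalSpace M] [ChartedSpace (EuclideanSpace ℝ (Fin (4 * n))) M]
      [IsManifold (𝓡 (4 * n)) ∞ M]
      [RiemannianBundle (fun p : M => TangentSpace (𝓡 (4 * n)) p)]
      [IsContMDiffRiemannianBundle (𝓡 (4 * n)) ∞ (EuclideanSpace ℝ (Fin (4 * n)))
        (fun p : M => TangentSpace (𝓡 (4 * n)) p)]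
      (cov : CovariantDerivative (𝓡 (4 * n)) (EuclideanSpace ℝ (Fin (4 * n)))
        (TangentSpace (𝓡 (4 * n)) : M → Type _))
      (J : Fin 3 → (p : M) → TangentSpace (𝓡 (4 * n)) p →L[ℝ] TangentSpace (𝓡 (4 * n)) p)
      (_hJ : IsHyperkahler cov J)
      (L : Type v) [TopologicalSpace L] [ChartedSpace (EuclideanSpace ℝ (Fin (2 * n))) L]
      [IsManifold (𝓡 (2 * n)) ∞ L]
      [RiemannianBundle (fun y : L => TangentSpace (𝓡 (2 * n)) y)]
      (F : L → M) (_hF : IsIsometricImmersion (𝓡 (4 * n)) (𝓡 (2 * n)) F)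
      (a : L → EuclideanSpace ℝ (Fin 3)) (_ha : IsComplexPhase J F a),
      (∀ (b : L → EuclideanSpace ℝ (Fin 3))
          (e : Fin n × Fin 2 → (y : L) → TangentSpace (𝓡 (2 * n)) y) (U : Set L)
          (_he : IsAdaptedFrame J F a b e U) (x : L) (_hx : x ∈ U),
          letI h := coeffSecondFundamentalForm cov J F b e x
          normSqCovEndAlong (I' := 𝓡 (2 * n)) cov F (fun y => twistor J (a y) (F y)) x
            = 4 * ∑ i : Fin n × Fin 2, ∑ ν : Fin n, ∑ μ : Fin n,
                ((h (μ, 0) (ν, 1) i - h (μ, 1) (ν, 0) i) ^ 2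
                  + (h (μ, 0) (ν, 0) i + h (μ, 1) (ν, 1) i) ^ 2)) ∧
      ∀ x : L,
        √(normSqCovEndAlong (I' := 𝓡 (2 * n)) cov F (fun y => twistor J (a y) (F y)) x)
            ≤ c * √(normSqSecondFundamentalForm (I' := 𝓡 (2 * n)) cov F x) ∧
        √(normSqGradient (𝓡 (2 * n)) a x)
            ≤ c * √(normSqSecondFundamentalForm (I' := 𝓡 (2 * n)) cov F x) := by
  -- The squared norms need the factors `16n` for `|∇̄J_Ψ|²` and `4` for `|∇a|²`; `(4(n + 1))²`
  -- dominates both, including when `n = 0`.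
  refine ⟨4 * (n + 1), ?_⟩
  intro M _ _ _ _ _ cov J hJ L _ _ _ _ F hF a ha
  refine ⟨fun b e U he x hx => he.normSqCovEndAlong_twistor hJ hF ha hx, fun x => ?_⟩
  have hn : (0 : ℝ) ≤ n := n.cast_nonneg
  have hgrad := ha.normSqGradient_le hJ hF x
  have hA : 0 ≤ normSqSecondFundamentalForm (I' := 𝓡 (2 * n)) cov F x :=
    Finset.sum_nonneg fun _ _ => Finset.sum_nonneg fun _ _ => sq_nonneg _
  have hend : normSqCovEndAlong (I' := 𝓡 (2 * n)) cov F (fun y => twistor J (a y) (F y)) x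
      = 4 * n * normSqGradient (𝓡 (2 * n)) a x := by
    rw [normSqGradient_eq ha.mdifferentiableAt]
    exact hJ.normSqCovEndAlong_twistor (hF.contMDiff.mdifferentiable (by simp) x)
      ha.mdifferentiableAt _
  have key : ∀ r : ℝ,
      r ≤ (4 * (n + 1)) ^ 2 * normSqSecondFundamentalForm (I' := 𝓡 (2 * n)) cov F x →
      √r ≤ 4 * (n + 1) * √(normSqSecondFundamentalForm (I' := 𝓡 (2 * n)) cov F x) := by
    intro r hr
    refine (Real.sqrt_le_sqrt hr).trans_eq ?_
    rw [Real.sqrt_mul (sq_nonneg _), Real.sqrt_sq (by positivity)]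
  refine ⟨key _ ?_, key _ (hgrad.trans (mul_le_mul_of_nonneg_right (by nlinarith) hA))⟩
  rw [hend]
  calc 4 * n * normSqGradient (𝓡 (2 * n)) a x
      ≤ 4 * n * (4 * normSqSecondFundamentalForm (I' := 𝓡 (2 * n)) cov F x) :=
        mul_le_mul_of_nonneg_left hgrad (by positivity)
    _ = 16 * n * normSqSecondFundamentalForm (I' := 𝓡 (2 * n)) cov F x := by ring
    _ ≤ _ := mul_le_mul_of_nonneg_right (by nlinarith) hA
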